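/- Let $c\in\mathbb{C}$ with $c\ne 1$ and $c\notin\{0,-1,-2,\dots\}$. Let $\Psi=\Gamma'/\Gamma$ be the digamma function, $\Psi'$ its derivative and $\gamma$ Euler's constant, and let $${}_4F_3(a_1,a_2,a_3,a_4;b_1,b_2,b_3;1)=\sum_{k\ge 0}\frac{(a_1)_k(a_2)_k(a_3)_k(a_4)_k}{(b_1)_k(b_2)_k(b_3)_k\,k!},$$ where $(a)_k=a(a+1)\cdots(a+k-1)$. Then the series ${}_4F_3(1,1,c,d;2,2,2;1)$ with $d=2-c,\ 1-c,\ -c,\ -1-c$ converge absolutely, and their sums are as follows. (Y3m1) $${}_4F_3(1,1,c,2-c;2,2,2;1)=\frac{1}{(c-1)^2}\left(2\gamma+2\Psi(c)+\frac{(\Psi'(c/2)-2\Psi'(c))\sin(\pi c)}{\pi}\right)-\frac{1}{(c-1)^3}-\frac{\sin(\pi c)}{\pi(c-1)^4};$$ (Y30) $${}_4F_3(1,1,c,1-c;2,2,2;1)=\frac{\sin(\pi c)}{\pi}\left(\frac{\Psi'(c/2)-2\Psi'(c)}{c(c-1)}-\frac{c^2-c+1}{c^3(c-1)^3}\right)+2\,\frac{\Psi(c+1)+\gamma}{c(c-1)}-\frac{2c-1}{c^2(c-1)^2};$$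 (Y31) $${}_4F_3(1,1,c,-c;2,2,2;1)=2\,\frac{\Psi(c+2)+\gamma}{(c-1)(c+1)}+\frac{1-3c^2}{c(c+1)^2(c-1)^2}-\frac{\Gamma(c)\sin(\pi c)}{\pi\,\Gamma(c+2)(c-1)^3}\left(c\,(2\Psi'(c)-\Psi'(c/2))(c-1)^2+\frac{c^4+c^3-2c^2+3c+1}{c(c+1)^2}\right);$$ (Y32) $${}_4F_3(1,1,c,-1-c;2,2,2;1)=2\,\frac{\Psi(3+c)+\gamma}{(c-1)(c+2)}-2\,\frac{(2c+1)(c^2+c-1)}{c(c+1)(c+2)^2(c-1)^2}+\frac{\Gamma(c)\sin(\pi c)\,4^c\,\Gamma(3/2+c)}{\pi^{3/2}(c+2)(c-1)^3\,\Gamma(2c+2)}\left(2c\,(\Psi'(c/2)-2\Psi'(c))(c-1)^2+\frac{-2c^6-10c^5-12c^4+14c^3-10c^2-44c-8}{(c+2)^2c(c+1)^2}\right),$$ where for $c\in\{-3/2,-5/2,-7/2,\dots\}$, at which $\Gamma(3/2+c)$ and $\Gamma(2c+2)$ both have poles, the right-hand side of (Y32) is read as its limit at $c$. -/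

import Mathlib

noncomputable section

/-- The Pochhammer symbol `(a)_k = a (a + 1) ⋯ (a + k - 1)`. -/
def poch (a : ℂ) (k : ℕ) : ℂ := (ascPochhammer ℂ k).eval a

/-- The `k`-th term of the hypergeometric series `₄F₃(a₁, a₂, a₃, a₄; b₁, b₂, b₃; z)`. -/
def hyp43Term (a₁ a₂ a₃ a₄ b₁ b₂ b₃ z : ℂ) (k : ℕ) : ℂ :=
  (poch a₁ k * poch a₂ k * poch a₃ k * poch a₄ k) / (poch b₁ k * poch b₂ k * poch b₃ k)
    * (z ^ k / (Nat.factorial k : ℂ))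

/-- The sum `₄F₃(a₁, a₂, a₃, a₄; b₁, b₂, b₃; z)` of the hypergeometric series. -/
def hyp43 (a₁ a₂ a₃ a₄ b₁ b₂ b₃ z : ℂ) : ℂ :=
  ∑' k : ℕ, hyp43Term a₁ a₂ a₃ a₄ b₁ b₂ b₃ z k

/-- The derivative `Ψ'` of the digamma function `Ψ`. -/
def trigamma (z : ℂ) : ℂ := deriv Complex.digamma z

/-- The closed form of `₄F₃(1, 1, c, 2 - c; 2, 2, 2; 1)`. -/
def closedFormTwoSub (c : ℂ) : ℂ :=
  1 / (c - 1) ^ 2 *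
      (2 * (Real.eulerMascheroniConstant : ℂ) + 2 * Complex.digamma c
        + (trigamma (c / 2) - 2 * trigamma c) * Complex.sin (Real.pi * c) / Real.pi)
    - 1 / (c - 1) ^ 3
    - Complex.sin (Real.pi * c) / (Real.pi * (c - 1) ^ 4)

/-- The closed form of `₄F₃(1, 1, c, 1 - c; 2, 2, 2; 1)`. -/
def closedFormOneSub (c : ℂ) : ℂ :=
  Complex.sin (Real.pi * c) / Real.pi *
      ((trigamma (c / 2) - 2 * trigamma c) / (c * (c - 1))
        - (c ^ 2 - c + 1) / (c ^ 3 * (c - 1) ^ 3))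
    + 2 * ((Complex.digamma (c + 1) + (Real.eulerMascheroniConstant : ℂ)) / (c * (c - 1)))
    - (2 * c - 1) / (c ^ 2 * (c - 1) ^ 2)

/-- The closed form of `₄F₃(1, 1, c, -c; 2, 2, 2; 1)`. -/
def closedFormNeg (c : ℂ) : ℂ :=
  2 * ((Complex.digamma (c + 2) + (Real.eulerMascheroniConstant : ℂ)) / ((c - 1) * (c + 1)))
    + (1 - 3 * c ^ 2) / (c * (c + 1) ^ 2 * (c - 1) ^ 2)
    - Complex.Gamma c * Complex.sin (Real.pi * c)
        / (Real.pi * Complex.Gamma (c + 2) * (c - 1) ^ 3) *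
      (c * (2 * trigamma c - trigamma (c / 2)) * (c - 1) ^ 2
        + (c ^ 4 + c ^ 3 - 2 * c ^ 2 + 3 * c + 1) / (c * (c + 1) ^ 2))

/-- The closed form of `₄F₃(1, 1, c, -1 - c; 2, 2, 2; 1)`. -/
def closedFormNegOneSub (c : ℂ) : ℂ :=
  2 * ((Complex.digamma (3 + c) + (Real.eulerMascheroniConstant : ℂ)) / ((c - 1) * (c + 2)))
    - 2 * ((2 * c + 1) * (c ^ 2 + c - 1) / (c * (c + 1) * (c + 2) ^ 2 * (c - 1) ^ 2))
    + Complex.Gamma c * Complex.sin (Real.pi * c) * (4 : ℂ) ^ c * Complex.Gamma (3 / 2 + c)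
        / ((Real.pi : ℂ) ^ (3 / 2 : ℂ) * (c + 2) * (c - 1) ^ 3 * Complex.Gamma (2 * c + 2)) *
      (2 * c * (trigamma (c / 2) - 2 * trigamma c) * (c - 1) ^ 2
        + (-2 * c ^ 6 - 10 * c ^ 5 - 12 * c ^ 4 + 14 * c ^ 3 - 10 * c ^ 2 - 44 * c - 8)
          / ((c + 2) ^ 2 * c * (c + 1) ^ 2))

end

open Filter Topology

/-! Put `a = c - 1`. Since `(2)_k = (k+1)!`, an index shift turns each series into a multiple of
`∑_{n ≥ 1} (a)_n (b)_n / (n!² n)` with `b = -a - m`, where `m = 0, 1, 2, 3` give the four values of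
`d`. Contiguous relations lower `b` by one at the cost of a Gauss sum `₂F₁(a, b; 1; 1)`
(`tsum_gaussTerm_neg_sub`, `tsum_logTerm_neg_sub`), so everything reduces to `b = -a`. There the
partial Gauss sums are exactly the partial products of Euler's sine product (`sum_gaussTerm_neg`).

The remaining function `logSum` is evaluated by uniqueness. It is entire, is bounded by a multiple
of `‖a‖ exp (π ‖a‖)`, and satisfies a first-order difference equation (`logSum_add_one`). The
proposed value satisfies the same equation, by the recurrence and duplication formulas of the
polygammas (`logSumClosed_add_one`), and it has comparable growth on the strip `1 ≤ Re a ≤ 2`. The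
difference of the two is therefore 1-periodic of exponential type below `2π`, hence constant
(`eq_of_add_one_of_norm_le_exp`), and it vanishes at `a = 1`. The four closed forms then follow by
rational algebra; the last one also needs Legendre duplication for its Gamma quotient, and
continuity at the exceptional points. -/

/-! ### Pochhammer symbols and reduction to Gauss terms. -/

lemma poch_zero (a : ℂ) : poch a 0 = 1 := by simp [poch]

lemma poch_succ (a : ℂ) (n : ℕ) : poch a (n + 1) = poch a n * (a + n) := by
  simp [poch, ascPochhammer_succ_eval]

lemma add_mul_poch (a : ℂ) (n : ℕ) : (a + n) * poch a n = a * poch (a + 1) n := by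
  induction n with
  | zero => simp [poch_zero]
  | succ n ih =>
    rw [poch_succ, poch_succ, ← mul_assoc a, ← ih]
    push_cast
    ring

lemma poch_succ_left (a : ℂ) (n : ℕ) : poch a (n + 1) = a * poch (a + 1) n := by
  rw [poch_succ, mul_comm, add_mul_poch]

lemma poch_one (n : ℕ) : poch 1 n = (n.factorial : ℂ) := by
  induction n with
  | zero => simp [poch_zero]
  | succ n ih =>
    rw [poch_succ, ih, Nat.factorial_succ]
    push_cast
    ring

lemma poch_two (n : ℕ) : poch 2 n = ((n + 1).factorial : ℂ) := by
  have h := poch_succ_left 1 n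
  rw [poch_one, one_mul] at h
  rw [h]
  norm_num

/-- The `n`-th term of the Gauss series `₂F₁(a, b; 1; 1)`. -/
noncomputable def gaussTerm (a b : ℂ) (n : ℕ) : ℂ := poch a n * poch b n / (n.factorial : ℂ) ^ 2

/-- The `n`-th term of `∑_{m ≥ 1} (a)_m (b)_m / (m!² m)`, where `m = n + 1`. -/
noncomputable def logTerm (a b : ℂ) (n : ℕ) : ℂ := gaussTerm a b (n + 1) / (n + 1)

lemma gaussTerm_zero (a b : ℂ) : gaussTerm a b 0 = 1 := by simp [gaussTerm, poch_zero]

lemma gaussTerm_comm (a b : ℂ) (n : ℕ) : gaussTerm a b n = gaussTerm b a n := by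
  simp [gaussTerm, mul_comm]

lemma logTerm_comm (a b : ℂ) (n : ℕ) : logTerm a b n = logTerm b a n := by
  simp [logTerm, gaussTerm_comm]

lemma gaussTerm_succ (a b : ℂ) (n : ℕ) :
    gaussTerm a b (n + 1) * ((n : ℂ) + 1) ^ 2 = (a + n) * (b + n) * gaussTerm a b n := by
  have h1 : (n.factorial : ℂ) ≠ 0 := by exact_mod_cast n.factorial_ne_zero
  have h2 : (n : ℂ) + 1 ≠ 0 := by exact_mod_cast n.succ_ne_zero
  simp only [gaussTerm, poch_succ, Nat.factorial_succ]
  push_cast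
  field_simp

lemma add_mul_gaussTerm_sub_one (a b : ℂ) (n : ℕ) :
    (b - 1 + n) * gaussTerm a (b - 1) n = (b - 1) * gaussTerm a b n := by
  have h := add_mul_poch (b - 1) n
  rw [sub_add_cancel] at h
  simp only [gaussTerm]
  linear_combination (poch a n / (n.factorial : ℂ) ^ 2) * h

/-- Uses `(c)_k = (c-1)_{k+1} / (c-1)` and `(2)_k = (k+1)!`: of the three factorials `(k+1)!`, two
form the Gauss denominator and the third leaves `1 / (k+1)` against `k!`. -/
lemma hyp43Term_eq_logTerm {c d : ℂ} (hc : c ≠ 1) (hd : d ≠ 1) (k : ℕ) :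
    hyp43Term 1 1 c d 2 2 2 1 k = 1 / ((c - 1) * (d - 1)) * logTerm (c - 1) (d - 1) k := by
  have h1 : (k.factorial : ℂ) ≠ 0 := by exact_mod_cast k.factorial_ne_zero
  have h2 : (k : ℂ) + 1 ≠ 0 := by exact_mod_cast k.succ_ne_zero
  have hc' := sub_ne_zero.2 hc
  have hd' := sub_ne_zero.2 hd
  simp only [hyp43Term, logTerm, gaussTerm, poch_one, poch_two, poch_succ_left, sub_add_cancel,
    Nat.factorial_succ, one_pow]
  push_cast
  field_simp

/-! ### Contiguous relations in the second parameter. -/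

lemma gaussTerm_sub (a b : ℂ) (n : ℕ) :
    (b - 1) * (gaussTerm a b n - gaussTerm a (b - 1) n) = n * gaussTerm a (b - 1) n := by
  linear_combination -add_mul_gaussTerm_sub_one a b n

lemma logTerm_sub {a b : ℂ} (hb : b ≠ 1) (n : ℕ) :
    logTerm a b n = logTerm a (b - 1) n + 1 / (b - 1) * gaussTerm a (b - 1) (n + 1) := by
  have h := gaussTerm_sub a b (n + 1)
  have h2 : (n : ℂ) + 1 ≠ 0 := by exact_mod_cast n.succ_ne_zero
  have hb' := sub_ne_zero.2 hb
  simp only [logTerm]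
  push_cast at h
  field_simp
  linear_combination h

/-- A telescoping certificate: summed over `n`, it gives the ratio of two neighbouring Gauss sums
without evaluating either of them. -/
lemma gaussTerm_contiguous {a b : ℂ} (hb : b ≠ 1) (n : ℕ) :
    (1 - b) * gaussTerm a (b - 1) n - (1 - a - b) * gaussTerm a b n =
      ((n + 1 : ℕ) : ℂ) ^ 2 * gaussTerm a (b - 1) (n + 1) / (b - 1)
        - (n : ℂ) ^ 2 * gaussTerm a (b - 1) n / (b - 1) := by
  have h1 := gaussTerm_succ a (b - 1) n
  have h2 := add_mul_gaussTerm_sub_one a b n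
  have hb' := sub_ne_zero.2 hb
  push_cast
  field_simp
  linear_combination (1 - a - b) * h2 - h1

/-! ### Quadratic decay and summed contiguous relations. -/

/-- The series `∑ gaussTerm a b n` is dominated by `∑ n⁻²`. -/
noncomputable def QuadDecay (a b : ℂ) : Prop :=
  gaussTerm a b =O[atTop] fun n : ℕ => 1 / (n : ℝ) ^ 2

lemma tendsto_div_add_natCast (b : ℂ) :
    Tendsto (fun n : ℕ => b / (b + n)) atTop (𝓝 0) := by
  have h : Tendsto (fun n : ℕ => b + (n : ℂ)) atTop (Bornology.cobounded ℂ) := by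
    refine tendsto_norm_atTop_iff_cobounded.1 ?_
    refine tendsto_atTop_mono (fun n => ?_)
      (tendsto_atTop_add_const_right _ (-‖b‖) tendsto_natCast_atTop_atTop)
    have := norm_sub_norm_le (n : ℂ) (-b)
    rw [norm_neg, sub_neg_eq_add, add_comm (n : ℂ), Complex.norm_natCast] at this
    linarith
  simpa [div_eq_mul_inv] using (tendsto_inv₀_cobounded.comp h).const_mul b

lemma gaussTerm_sub_one_eventuallyEq (a b : ℂ) :
    gaussTerm a (b - 1) =ᶠ[atTop] fun n => (b - 1) / (b - 1 + n) * gaussTerm a b n := by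
  have : ∀ᶠ n : ℕ in atTop, b - 1 + (n : ℂ) ≠ 0 := by
    filter_upwards [eventually_gt_atTop ⌈‖b - 1‖⌉₊] with n hn h
    have h1 : ‖b - 1‖ < n := Nat.lt_of_ceil_lt hn
    rw [eq_neg_of_add_eq_zero_left h] at h1
    simp at h1
  filter_upwards [this] with n hn
  have := add_mul_gaussTerm_sub_one a b n
  field_simp
  linear_combination this

lemma QuadDecay.sub_one {a b : ℂ} (h : QuadDecay a b) : QuadDecay a (b - 1) := by
  have h1 := ((tendsto_div_add_natCast (b - 1)).isBigO_one ℝ).mul h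
  refine (gaussTerm_sub_one_eventuallyEq a b).trans_isBigO ?_
  simpa using h1

/-- Lowering `b` multiplies the term by `(b-1) / (b-1+n)`, which tends to zero and so improves
`O(n⁻²)` to `o(n⁻²)`. This removes the boundary term of the telescoping sum. -/
lemma QuadDecay.tendsto_sub_one {a b : ℂ} (h : QuadDecay a b) :
    Tendsto (fun n : ℕ => (n : ℂ) ^ 2 * gaussTerm a (b - 1) n) atTop (𝓝 0) := by
  have h1 : gaussTerm a (b - 1) =o[atTop] fun n : ℕ => 1 / (n : ℝ) ^ 2 := by
    refine (gaussTerm_sub_one_eventuallyEq a b).trans_isLittleO ?_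
    have := ((Asymptotics.isLittleO_one_iff ℝ).2 (tendsto_div_add_natCast (b - 1))).mul_isBigO h
    simpa using this
  have h2 : (fun n : ℕ => (n : ℂ) ^ 2) =O[atTop] fun n : ℕ => (n : ℝ) ^ 2 :=
    Asymptotics.isBigO_of_le _ fun n => by simp
  have h3 := h2.mul_isLittleO h1
  refine (Asymptotics.isLittleO_one_iff ℝ).1 (h3.trans_isBigO ?_)
  refine Asymptotics.isBigO_of_le _ fun n => ?_
  rcases eq_or_ne n 0 with rfl | hn
  · simp
  · have : (n : ℝ) ≠ 0 := by exact_mod_cast hn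
    simp [this]

lemma QuadDecay.summable {a b : ℂ} (h : QuadDecay a b) : Summable (gaussTerm a b) :=
  summable_of_isBigO_nat (Real.summable_one_div_nat_pow.2 one_lt_two) h

lemma QuadDecay.summable_logTerm {a b : ℂ} (h : QuadDecay a b) : Summable (logTerm a b) := by
  refine Summable.of_norm_bounded ((summable_nat_add_iff 1).2 h.summable).norm fun n => ?_
  simp only [logTerm, norm_div]
  refine div_le_self (norm_nonneg _) ?_
  have : ‖(n : ℂ) + 1‖ = n + 1 := by exact_mod_cast Complex.norm_natCast (n + 1)
  rw [this]
  simp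

lemma QuadDecay.tsum_gaussTerm_sub_one {a b : ℂ} (h : QuadDecay a b) (hb : b ≠ 1) :
    (1 - b) * ∑' n, gaussTerm a (b - 1) n = (1 - a - b) * ∑' n, gaussTerm a b n := by
  have h1 := (h.sub_one.summable.hasSum.mul_left (1 - b)).sub
    (h.summable.hasSum.mul_left (1 - a - b))
  have h2 := h1.tendsto_sum_nat
  have h3 : Tendsto (fun n : ℕ => (n : ℂ) ^ 2 * gaussTerm a (b - 1) n / (b - 1)) atTop (𝓝 0) := by
    simpa using h.tendsto_sub_one.div_const (b - 1)
  refine sub_eq_zero.1 (tendsto_nhds_unique h2 (h3.congr fun n => ?_))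
  simp only [gaussTerm_contiguous hb]
  rw [Finset.sum_range_sub (fun n : ℕ => (n : ℂ) ^ 2 * gaussTerm a (b - 1) n / (b - 1))]
  simp

lemma QuadDecay.tsum_logTerm_sub_one {a b : ℂ} (h : QuadDecay a (b - 1)) (hb : b ≠ 1) :
    Summable (logTerm a b) ∧ ∑' n, logTerm a b n =
      ∑' n, logTerm a (b - 1) n + 1 / (b - 1) * (∑' n, gaussTerm a (b - 1) n - 1) := by
  have h1 : HasSum (fun n => gaussTerm a (b - 1) (n + 1)) (∑' n, gaussTerm a (b - 1) n - 1) := by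
    rw [h.summable.tsum_eq_zero_add, gaussTerm_zero, add_sub_cancel_left]
    exact ((summable_nat_add_iff 1).2 h.summable).hasSum
  have h2 := h.summable_logTerm.hasSum.add (h1.mul_left (1 / (b - 1)))
  simp only [← logTerm_sub hb] at h2
  exact ⟨h2.summable, h2.tsum_eq⟩

/-! ### The case `b = -a` and Euler's sine product. -/

/-- The partial product `∏_{j = 1}^n (1 - a² / j²)` of the Euler product of the sine. -/
noncomputable def eulerProd (a : ℂ) (n : ℕ) : ℂ := ∏ j ∈ Finset.range n, (1 - a ^ 2 / ((j : ℂ) + 1) ^ 2)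

lemma gaussTerm_neg_succ (a : ℂ) (n : ℕ) :
    gaussTerm a (-a) (n + 1) = -a ^ 2 / ((n : ℂ) + 1) ^ 2 * eulerProd a n := by
  induction n with
  | zero => simp [gaussTerm, eulerProd, poch_succ, poch_zero]; ring
  | succ n ih =>
    have h := gaussTerm_succ a (-a) (n + 1)
    have h2 : (n : ℂ) + 1 ≠ 0 := by exact_mod_cast n.succ_ne_zero
    have h3 : (n : ℂ) + 1 + 1 ≠ 0 := by exact_mod_cast (n + 1).succ_ne_zero
    rw [ih] at h
    rw [eulerProd, Finset.prod_range_succ, ← eulerProd]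
    push_cast at h ⊢
    rw [← eq_div_iff (pow_ne_zero 2 h3)] at h
    rw [h]
    field_simp
    ring

/-- Each new term is exactly the increment of the product, so the Gauss sum is obtained as a limit
of Euler products. -/
lemma sum_gaussTerm_neg (a : ℂ) (n : ℕ) :
    ∑ k ∈ Finset.range (n + 1), gaussTerm a (-a) k = eulerProd a n := by
  induction n with
  | zero => simp [gaussTerm_zero, eulerProd]
  | succ n ih =>
    rw [Finset.sum_range_succ, ih, gaussTerm_neg_succ, eulerProd, eulerProd,
      Finset.prod_range_succ]
    ring

/-- Replacing each factor by `1 + ‖a‖² / j²` gives the sine product at `i‖a‖`, whose partial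
products increase to their limit. The factor `‖a‖` on the left avoids a division at `a = 0`; it is
one of the two factors `a` available in `gaussTerm_neg_succ`. -/
lemma norm_eulerProd_le (a : ℂ) (n : ℕ) :
    ‖a‖ * ‖eulerProd a n‖ ≤ Real.exp (Real.pi * ‖a‖) := by
  set r := ‖a‖
  have h1 : ‖eulerProd a n‖ ≤ ∏ j ∈ Finset.range n, (1 + r ^ 2 / ((j : ℝ) + 1) ^ 2) := by
    rw [eulerProd, norm_prod]
    refine Finset.prod_le_prod (fun _ _ => norm_nonneg _) fun j _ => ?_
    refine (norm_sub_le _ _).trans ?_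
    have : ‖(j : ℂ) + 1‖ = j + 1 := by exact_mod_cast Complex.norm_natCast (j + 1)
    simp [this, r]
  have h2 := (Complex.tendsto_euler_sin_prod (r * Complex.I)).norm
  have h3 : ∀ n : ℕ, ‖(Real.pi : ℂ) * (r * Complex.I) *
      ∏ j ∈ Finset.range n, ((1 : ℂ) - (r * Complex.I) ^ 2 / ((j : ℂ) + 1) ^ 2)‖ =
      Real.pi * r * ∏ j ∈ Finset.range n, (1 + r ^ 2 / ((j : ℝ) + 1) ^ 2) := by
    intro n
    have : ∏ j ∈ Finset.range n, ((1 : ℂ) - (r * Complex.I) ^ 2 / ((j : ℂ) + 1) ^ 2) =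
        ((∏ j ∈ Finset.range n, (1 + r ^ 2 / ((j : ℝ) + 1) ^ 2) : ℝ) : ℂ) := by
      push_cast
      refine Finset.prod_congr rfl fun j _ => ?_
      rw [mul_pow, Complex.I_sq]
      ring
    rw [this, norm_mul, norm_mul, norm_mul, Complex.norm_real, Complex.norm_real, Complex.norm_real,
      Complex.norm_I, mul_one, Real.norm_of_nonneg Real.pi_pos.le,
      Real.norm_of_nonneg (norm_nonneg a), Real.norm_of_nonneg (by positivity)]
  simp only [h3] at h2
  have hmono : Monotone fun n : ℕ =>
      Real.pi * r * ∏ j ∈ Finset.range n, (1 + r ^ 2 / ((j : ℝ) + 1) ^ 2) := by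
    refine monotone_nat_of_le_succ fun n => ?_
    rw [Finset.prod_range_succ, ← mul_assoc]
    refine le_mul_of_one_le_right (by positivity) ?_
    have : 0 ≤ r ^ 2 / ((n : ℝ) + 1) ^ 2 := by positivity
    linarith
  have h4 := hmono.ge_of_tendsto h2 n
  have h5 : ‖Complex.sin (Real.pi * (r * Complex.I))‖ ≤ Real.exp (Real.pi * r) := by
    have : (Real.pi : ℂ) * (r * Complex.I) = ((Real.pi * r : ℝ) : ℂ) * Complex.I := by
      push_cast; ring
    rw [this, Complex.sin_mul_I, norm_mul, Complex.norm_I, mul_one, ← Complex.ofReal_sinh,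
      Complex.norm_real, Real.norm_eq_abs, Real.abs_sinh, abs_of_nonneg (by positivity),
      Real.sinh_eq]
    have := Real.exp_pos (-(Real.pi * r))
    have := Real.exp_pos (Real.pi * r)
    linarith
  calc r * ‖eulerProd a n‖
      ≤ r * ∏ j ∈ Finset.range n, (1 + r ^ 2 / ((j : ℝ) + 1) ^ 2) := by gcongr
    _ ≤ Real.pi * (r * ∏ j ∈ Finset.range n, (1 + r ^ 2 / ((j : ℝ) + 1) ^ 2)) := by
        refine le_mul_of_one_le_left (by positivity) ?_
        linarith [Real.pi_gt_three]
    _ ≤ _ := by rw [← mul_assoc]; exact h4.trans h5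

lemma norm_gaussTerm_neg_le (a : ℂ) (n : ℕ) :
    ‖gaussTerm a (-a) (n + 1)‖ ≤ ‖a‖ * Real.exp (Real.pi * ‖a‖) / ((n : ℝ) + 1) ^ 2 := by
  have : ‖(n : ℂ) + 1‖ = n + 1 := by exact_mod_cast Complex.norm_natCast (n + 1)
  rw [gaussTerm_neg_succ, norm_mul, norm_div, norm_neg, norm_pow, norm_pow, this, div_mul_eq_mul_div,
    pow_two ‖a‖, mul_assoc]
  gcongr
  exact norm_eulerProd_le a n

lemma quadDecay_neg (a : ℂ) : QuadDecay a (-a) := by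
  refine Asymptotics.IsBigO.of_bound (‖a‖ * Real.exp (Real.pi * ‖a‖)) ?_
  filter_upwards [eventually_ge_atTop 1] with n hn
  obtain ⟨m, rfl⟩ := Nat.exists_eq_add_of_le' hn
  refine (norm_gaussTerm_neg_le a m).trans (le_of_eq ?_)
  simp [div_eq_mul_inv]

lemma tsum_gaussTerm_neg {a : ℂ} (ha : a ≠ 0) :
    ∑' n, gaussTerm a (-a) n = Complex.sin (Real.pi * a) / (Real.pi * a) := by
  have h1 := ((tendsto_add_atTop_iff_nat 1).2 (quadDecay_neg a).summable.hasSum.tendsto_sum_nat)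
  simp only [sum_gaussTerm_neg] at h1
  have h2 := (Complex.tendsto_euler_sin_prod a).div_const (Real.pi * a)
  refine tendsto_nhds_unique h1 (h2.congr fun n => ?_)
  have : (Real.pi : ℂ) ≠ 0 := by exact_mod_cast Real.pi_ne_zero
  rw [← eulerProd]
  field_simp

/-! ### The entire function `logSum` and its difference equation. -/

/-- The sum `∑_{n ≥ 1} (a)_n (-a)_n / (n!² n)`. -/
noncomputable def logSum (a : ℂ) : ℂ := ∑' n, logTerm a (-a) n

lemma norm_logTerm_neg_le (a : ℂ) (n : ℕ) :
    ‖logTerm a (-a) n‖ ≤ ‖a‖ * Real.exp (Real.pi * ‖a‖) * (1 / ((n : ℝ) + 1) ^ 2) := by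
  have : ‖(n : ℂ) + 1‖ = n + 1 := by exact_mod_cast Complex.norm_natCast (n + 1)
  rw [logTerm, norm_div, this, mul_one_div]
  refine (div_le_self (norm_nonneg _) (by simp)).trans (norm_gaussTerm_neg_le a n)

lemma summable_one_div_succ_sq : Summable fun n : ℕ => 1 / ((n : ℝ) + 1) ^ 2 := by
  have := (summable_nat_add_iff 1).2 (Real.summable_one_div_nat_pow.2 one_lt_two)
  simpa using this

lemma norm_logSum_le (a : ℂ) :
    ‖logSum a‖ ≤ ‖a‖ * Real.exp (Real.pi * ‖a‖) * ∑' n : ℕ, 1 / ((n : ℝ) + 1) ^ 2 :=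
  tsum_of_norm_bounded (summable_one_div_succ_sq.hasSum.mul_left _) (norm_logTerm_neg_le a)

lemma differentiable_logSum : Differentiable ℂ logSum := by
  intro a
  have hU : IsOpen (Metric.ball (0 : ℂ) (‖a‖ + 1)) := Metric.isOpen_ball
  have ha : a ∈ Metric.ball (0 : ℂ) (‖a‖ + 1) := by simp
  refine (Complex.differentiableOn_tsum_of_summable_norm
    (u := fun n : ℕ => (‖a‖ + 1) * Real.exp (Real.pi * (‖a‖ + 1)) * (1 / ((n : ℝ) + 1) ^ 2))
    (summable_one_div_succ_sq.mul_left _) (fun n => ?_) hU fun n w hw => ?_).differentiableAt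
    (hU.mem_nhds ha)
  · have : (fun w => logTerm w (-w) n) =
        fun w => -w ^ 2 / ((n : ℂ) + 1) ^ 2 * eulerProd w n / (n + 1) := by
      ext w
      rw [logTerm, gaussTerm_neg_succ]
    rw [this]
    unfold eulerProd
    fun_prop
  · have hw' : ‖w‖ ≤ ‖a‖ + 1 := by simpa using (Metric.mem_ball.1 hw).le
    refine (norm_logTerm_neg_le w n).trans ?_
    have := Real.pi_pos.le
    gcongr

/-- The sum with parameters `(a+1, -a)` is computed twice: lowering `-a` leads to `logSum (a+1)`,
lowering `a+1` leads to `logSum a`. -/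
lemma logSum_add_one {a : ℂ} (h0 : a ≠ 0) (h1 : a + 1 ≠ 0) :
    logSum (a + 1) = logSum a + (Complex.sin (Real.pi * a) / (Real.pi * a) - 1) / a
      + (Complex.sin (Real.pi * (a + 1)) / (Real.pi * (a + 1)) - 1) / (a + 1) := by
  have e1 : (-a : ℂ) - 1 = -(a + 1) := by ring
  have k1 : QuadDecay (a + 1) (-a - 1) := e1 ▸ quadDecay_neg (a + 1)
  have k2 : QuadDecay (-a) (a + 1 - 1) := by
    have := quadDecay_neg (-a)
    simpa using this
  have s1 := (k1.tsum_logTerm_sub_one (fun h => h1 (by linear_combination -h))).2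
  have s2 := (k2.tsum_logTerm_sub_one (fun h => h0 (by linear_combination h))).2
  rw [e1, tsum_gaussTerm_neg h1] at s1
  rw [add_sub_cancel_right] at s2
  simp only [gaussTerm_comm (-a) a, logTerm_comm (-a), tsum_gaussTerm_neg h0] at s2
  rw [s1] at s2
  rw [logSum, logSum]
  rw [show (1 : ℂ) / -(a + 1) = -(1 / (a + 1)) by rw [div_neg]] at s2
  linear_combination s2

lemma logSum_one : logSum 1 = -1 := by
  rw [logSum, tsum_eq_single 0]
  · simp [logTerm, gaussTerm, poch_succ, poch_zero]
  · intro n hn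
    obtain ⟨m, rfl⟩ := Nat.exists_eq_succ_of_ne_zero hn
    rw [logTerm, gaussTerm_neg_succ, eulerProd, Finset.prod_eq_zero (i := 0)]
    · simp
    · simp
    · simp

/-! ### The Weierstrass product and the digamma series. -/

lemma isOpen_setOf_ne_neg_natCast : IsOpen {z : ℂ | ∀ n : ℕ, z ≠ -n} := by
  have : {z : ℂ | ∀ n : ℕ, z ≠ -n} = {z : ℂ | (Complex.Gamma z)⁻¹ ≠ 0} := by
    ext z
    simp [Complex.Gamma_eq_zero_iff]
  rw [this]
  exact isOpen_ne_fun Complex.differentiable_one_div_Gamma.continuous continuous_const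

/-- The factor `(1 + z / (k + 1)) e^{-z / (k + 1)}` of the Weierstrass product of `1 / Γ`. -/
noncomputable def gammaFactor (k : ℕ) (z : ℂ) : ℂ :=
  (1 + z / ((k : ℂ) + 1)) * Complex.exp (-(z / ((k : ℂ) + 1)))

lemma norm_natCast_add_one (k : ℕ) : ‖(k : ℂ) + 1‖ = (k : ℝ) + 1 := by
  exact_mod_cast Complex.norm_natCast (k + 1)

lemma natCast_add_one_ne_zero (k : ℕ) : (k : ℂ) + 1 ≠ 0 := by
  exact_mod_cast k.succ_ne_zero

lemma differentiable_gammaFactor (k : ℕ) : Differentiable ℂ (gammaFactor k) := by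
  unfold gammaFactor
  fun_prop

/-- The left side is the second-order Taylor remainder of `exp w` times `-exp (-w)`; the quadratic
smallness makes the Weierstrass product converge. -/
lemma norm_one_add_mul_exp_neg_sub_one_le (w : ℂ) :
    ‖(1 + w) * Complex.exp (-w) - 1‖ ≤ ‖w‖ ^ 2 * Real.exp (2 * ‖w‖) := by
  have h1 := Complex.norm_exp_sub_sum_le_norm_mul_exp w 2
  have h2 : (1 + w) * Complex.exp (-w) - 1 =
      -(Complex.exp w - ∑ m ∈ Finset.range 2, w ^ m / m.factorial) * Complex.exp (-w) := by
    have : Complex.exp w * Complex.exp (-w) = 1 := by rw [← Complex.exp_add]; simp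
    simp [Finset.sum_range_succ]
    linear_combination this
  rw [h2, norm_mul, norm_neg, two_mul, Real.exp_add, ← mul_assoc]
  gcongr
  simpa using Complex.norm_exp_le_exp_norm (-w)

lemma multipliableLocallyUniformlyOn_gammaFactor (R : ℝ) :
    MultipliableLocallyUniformlyOn gammaFactor (Metric.ball 0 R) := by
  have h := Summable.multipliableLocallyUniformlyOn_nat_one_add
    (f := fun k z => gammaFactor k z - 1) (K := Metric.ball (0 : ℂ) R)
    (u := fun k : ℕ => R ^ 2 * Real.exp (2 * R) * (1 / ((k : ℝ) + 1) ^ 2)) Metric.isOpen_ball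
    (summable_one_div_succ_sq.mul_left _) (Eventually.of_forall fun k z hz => ?_)
    (fun k => ((differentiable_gammaFactor k).continuous.sub continuous_const).continuousOn)
  · simpa using h
  · have hz' : ‖z‖ ≤ R := by simpa using (Metric.mem_ball.1 hz).le
    refine (norm_one_add_mul_exp_neg_sub_one_le _).trans ?_
    rw [norm_div, norm_natCast_add_one, div_pow, mul_one_div, div_mul_eq_mul_div]
    have : ‖z‖ / ((k : ℝ) + 1) ≤ R := (div_le_self (norm_nonneg _) (by simp)).trans hz'
    gcongr

/-- Writing `n ^ z` as `exp (z log n)` pairs the exponential factors into `harmonic n - log n`,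
which produces Euler's constant in the limit. -/
lemma prod_gammaFactor {z : ℂ} (hz : z ≠ 0) (n : ℕ) (hn : n ≠ 0) :
    ∏ k ∈ Finset.range n, gammaFactor k z =
      Complex.exp (-(z * ((harmonic n : ℝ) - Real.log n : ℝ))) * (z * Complex.GammaSeq z n)⁻¹ := by
  have h1 : ∏ k ∈ Finset.range n, Complex.exp (-(z / ((k : ℂ) + 1))) =
      Complex.exp (-(z * (harmonic n : ℝ))) := by
    rw [← Complex.exp_sum, Finset.sum_neg_distrib, harmonic]
    push_cast
    rw [Finset.mul_sum]
    simp [div_eq_mul_inv]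
  have h2 : ∏ k ∈ Finset.range n, (1 + z / ((k : ℂ) + 1)) =
      (∏ k ∈ Finset.range n, (z + (k + 1 : ℕ))) / (n.factorial : ℂ) := by
    rw [← Finset.prod_range_add_one_eq_factorial, Nat.cast_prod, ← Finset.prod_div_distrib]
    refine Finset.prod_congr rfl fun k _ => ?_
    have := natCast_add_one_ne_zero k
    push_cast
    field_simp
    ring
  have h3 : (n : ℂ) ^ z = Complex.exp (z * (Real.log n : ℝ)) := by
    rw [Complex.cpow_def_of_ne_zero (by exact_mod_cast hn), Complex.ofReal_log (by positivity),
      mul_comm]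
    simp
  have h4 : (n.factorial : ℂ) ≠ 0 := by exact_mod_cast n.factorial_ne_zero
  simp only [gammaFactor]
  rw [Finset.prod_mul_distrib, h1, h2, Complex.GammaSeq, Finset.prod_range_succ', h3]
  have h5 := Complex.exp_ne_zero (z * (Real.log n : ℝ))
  have h6 : Complex.exp (-(z * ((harmonic n : ℝ) - Real.log n : ℝ))) =
      Complex.exp (-(z * (harmonic n : ℝ))) * Complex.exp (z * (Real.log n : ℝ)) := by
    rw [← Complex.exp_add]
    push_cast
    ring_nf
  rw [h6]
  simp only [Nat.cast_zero, add_zero, inv_div, mul_inv]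
  field_simp

lemma tprod_gammaFactor {z : ℂ} (hz : ∀ n : ℕ, z ≠ -n) :
    ∏' k, gammaFactor k z =
      Complex.exp (-(z * Real.eulerMascheroniConstant)) * (Complex.Gamma (z + 1))⁻¹ := by
  have h0 : z ≠ 0 := by simpa using hz 0
  have hm : Multipliable fun k => gammaFactor k z :=
    (multipliableLocallyUniformlyOn_gammaFactor (‖z‖ + 1)).multipliable (by simp)
  have h1 := hm.hasProd.tendsto_prod_nat
  have h2 : Tendsto (fun n : ℕ => Complex.exp (-(z * ((harmonic n : ℝ) - Real.log n : ℝ))) *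
      (z * Complex.GammaSeq z n)⁻¹) atTop
      (𝓝 (Complex.exp (-(z * Real.eulerMascheroniConstant)) * (z * Complex.Gamma z)⁻¹)) := by
    refine Tendsto.mul ?_ (((Complex.GammaSeq_tendsto_Gamma z).const_mul z).inv₀
      (mul_ne_zero h0 (Complex.Gamma_ne_zero hz)))
    have := (Complex.continuous_ofReal.tendsto _).comp Real.tendsto_harmonic_sub_log
    exact (Complex.continuous_exp.tendsto _).comp (this.const_mul z).neg
  rw [Complex.Gamma_add_one z h0]
  refine tendsto_nhds_unique h1 (h2.congr' ?_)
  filter_upwards [eventually_ne_atTop 0] with n hn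
  rw [prod_gammaFactor h0 n hn]

lemma logDeriv_gammaFactor {z : ℂ} (hz : ∀ n : ℕ, z ≠ -n) (k : ℕ) :
    gammaFactor k z ≠ 0 ∧
      logDeriv (gammaFactor k) z = -(z / (((k : ℂ) + 1) * (k + 1 + z))) := by
  have h1 := natCast_add_one_ne_zero k
  have h2 : (k : ℂ) + 1 + z ≠ 0 := fun h => hz (k + 1) (by push_cast; linear_combination h)
  have h3 : 1 + z / ((k : ℂ) + 1) ≠ 0 := by
    rw [one_add_div h1]
    exact div_ne_zero h2 h1
  refine ⟨mul_ne_zero h3 (Complex.exp_ne_zero _), ?_⟩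
  have d1 : HasDerivAt (fun z : ℂ => 1 + z / ((k : ℂ) + 1)) (1 / ((k : ℂ) + 1)) z :=
    ((hasDerivAt_id z).div_const _).const_add 1
  have d2 := ((hasDerivAt_id z).div_const ((k : ℂ) + 1)).neg.cexp
  have d3 := (d1.mul d2).deriv
  have h4 := Complex.exp_ne_zero (-(z / ((k : ℂ) + 1)))
  rw [logDeriv_apply]
  have : deriv (gammaFactor k) z = _ := d3
  rw [this, gammaFactor]
  simp only [id, Pi.neg_apply]
  field_simp
  ring

lemma summable_digamma_series (z : ℂ) :
    Summable fun k : ℕ => z / (((k : ℂ) + 1) * (k + 1 + z)) := by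
  refine summable_of_isBigO_nat (summable_one_div_succ_sq) ?_
  refine Asymptotics.IsBigO.of_bound (2 * ‖z‖) ?_
  filter_upwards [eventually_ge_atTop ⌈2 * ‖z‖⌉₊] with k hk
  have hk' : 2 * ‖z‖ ≤ k := Nat.ceil_le.1 hk
  have h1 : ((k : ℝ) + 1) / 2 ≤ ‖(k : ℂ) + 1 + z‖ := by
    have := norm_sub_norm_le ((k : ℂ) + 1) (-z)
    rw [norm_neg, sub_neg_eq_add, norm_natCast_add_one] at this
    linarith
  have h2 : (0 : ℝ) < (k : ℝ) + 1 := by positivity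
  rw [norm_div, norm_mul, norm_natCast_add_one, Real.norm_of_nonneg (by positivity)]
  calc ‖z‖ / (((k : ℝ) + 1) * ‖(k : ℂ) + 1 + z‖)
      ≤ ‖z‖ / (((k : ℝ) + 1) * (((k : ℝ) + 1) / 2)) := by gcongr
    _ = 2 * ‖z‖ * (1 / ((k : ℝ) + 1) ^ 2) := by field_simp

/-- Termwise logarithmic differentiation of the Weierstrass product. -/
lemma digamma_add_one_eq_tsum {z : ℂ} (hz : ∀ n : ℕ, z ≠ -n) :
    Complex.digamma (z + 1) = -Real.eulerMascheroniConstant +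
      ∑' k : ℕ, z / (((k : ℂ) + 1) * (k + 1 + z)) := by
  have hz1 : ∀ n : ℕ, z + 1 ≠ -n := fun n h => hz (n + 1) (by push_cast; linear_combination h)
  have hG := Complex.Gamma_ne_zero hz1
  have hGd := Complex.differentiableAt_Gamma _ hz1
  have hx : z ∈ Metric.ball (0 : ℂ) (‖z‖ + 1) := by simp
  have hev : (fun w => ∏' k, gammaFactor k w) =ᶠ[𝓝 z] fun w =>
      Complex.exp (-(w * Real.eulerMascheroniConstant)) * (Complex.Gamma (w + 1))⁻¹ := by
    filter_upwards [isOpen_setOf_ne_neg_natCast.mem_nhds hz] with w hw using tprod_gammaFactor hw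
  have h := logDeriv_tprod_eq_tsum Metric.isOpen_ball hx
    (fun k => (logDeriv_gammaFactor hz k).1)
    (fun k => (differentiable_gammaFactor k).differentiableOn)
    (by simpa only [(logDeriv_gammaFactor hz _).2] using (summable_digamma_series z).neg)
    (multipliableLocallyUniformlyOn_gammaFactor (‖z‖ + 1))
    (by rw [tprod_gammaFactor hz]; exact mul_ne_zero (Complex.exp_ne_zero _) (inv_ne_zero hG))
  simp only [(logDeriv_gammaFactor hz _).2, tsum_neg] at h
  have d1 : HasDerivAt (fun w : ℂ => Complex.exp (-(w * Real.eulerMascheroniConstant)))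
      (Complex.exp (-(z * Real.eulerMascheroniConstant)) * -(1 * Real.eulerMascheroniConstant)) z :=
    ((hasDerivAt_id z).mul_const _).neg.cexp
  have d2 : HasDerivAt (fun w : ℂ => (Complex.Gamma (w + 1))⁻¹)
      (-deriv Complex.Gamma (z + 1) / Complex.Gamma (z + 1) ^ 2) z := by
    have : HasDerivAt (fun w : ℂ => Complex.Gamma (w + 1)) (deriv Complex.Gamma (z + 1)) z :=
      HasDerivAt.comp_add_const z 1 hGd.hasDerivAt
    exact this.inv hG
  have h2 : logDeriv (fun w => ∏' k, gammaFactor k w) z =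
      -Real.eulerMascheroniConstant - Complex.digamma (z + 1) := by
    rw [logDeriv_apply, hev.deriv_eq, hev.eq_of_nhds, show deriv (fun w : ℂ => Complex.exp (-(w * Real.eulerMascheroniConstant)) *
      (Complex.Gamma (w + 1))⁻¹) z = _ from (d1.mul d2).deriv, Complex.digamma_def,
      logDeriv_apply]
    have := Complex.exp_ne_zero (-(z * Real.eulerMascheroniConstant))
    field_simp
    ring
  rw [h2] at h
  linear_combination -h

/-! ### Growth of digamma and trigamma in a half plane. -/

lemma norm_digamma_le : ∃ C : ℝ, 0 ≤ C ∧ ∀ z : ℂ, 1 / 2 ≤ z.re →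
    ‖Complex.digamma z‖ ≤ C * (1 + ‖z‖) := by
  obtain ⟨S, hS⟩ : ∃ S, S = ∑' n : ℕ, 1 / ((n : ℝ) + 1) ^ 2 := ⟨_, rfl⟩
  have hS0 : 0 ≤ S := hS ▸ tsum_nonneg fun n => by positivity
  have hg := Real.eulerMascheroniConstant_lt_two_thirds
  have hg' := Real.one_half_lt_eulerMascheroniConstant
  refine ⟨1 + 2 * S, by positivity, fun z hz => ?_⟩
  rcases eq_or_ne z 1 with rfl | h1
  · rw [Complex.digamma_one]
    simp only [norm_neg, Complex.norm_real, norm_one, Real.norm_eq_abs]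
    rw [abs_of_pos (by linarith)]
    nlinarith
  have hne : ∀ n : ℕ, z - 1 ≠ -n := by
    intro n hn
    have h2 := congrArg Complex.re hn
    simp at h2
    rcases n with _ | n
    · exact h1 (by simpa [sub_eq_zero] using hn)
    · push_cast at h2
      have : (0 : ℝ) ≤ n := n.cast_nonneg
      linarith
  have h := digamma_add_one_eq_tsum hne
  rw [sub_add_cancel] at h
  have hb : ∀ k : ℕ, ‖(z - 1) / (((k : ℂ) + 1) * (k + 1 + (z - 1)))‖ ≤
      2 * ‖z - 1‖ * (1 / ((k : ℝ) + 1) ^ 2) := by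
    intro k
    -- The real part is `k + Re z ≥ k + 1/2`, so the bound is uniform in `Im z` and the series grows
    -- at most linearly.
    have h3 : ((k : ℝ) + 1) / 2 ≤ ‖(k : ℂ) + 1 + (z - 1)‖ := by
      refine le_trans ?_ (Complex.re_le_norm _)
      have : (0 : ℝ) ≤ k := k.cast_nonneg
      simp
      linarith
    rw [norm_div, norm_mul, norm_natCast_add_one]
    calc ‖z - 1‖ / (((k : ℝ) + 1) * ‖(k : ℂ) + 1 + (z - 1)‖)
        ≤ ‖z - 1‖ / (((k : ℝ) + 1) * (((k : ℝ) + 1) / 2)) := by gcongr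
      _ = 2 * ‖z - 1‖ * (1 / ((k : ℝ) + 1) ^ 2) := by field_simp
  have h4 := tsum_of_norm_bounded (summable_one_div_succ_sq.hasSum.mul_left (2 * ‖z - 1‖)) hb
  rw [← hS] at h4
  have h5 : ‖z - 1‖ ≤ 1 + ‖z‖ := by
    refine (norm_sub_le _ _).trans ?_
    rw [norm_one, add_comm]
  rw [h]
  refine (norm_add_le _ _).trans ?_
  rw [norm_neg, Complex.norm_real, Real.norm_eq_abs, abs_of_pos (by linarith)]
  have h6 : 2 * ‖z - 1‖ * S ≤ 2 * (1 + ‖z‖) * S := by gcongr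
  have := norm_nonneg z
  linarith

lemma differentiableAt_digamma {z : ℂ} (hz : ∀ n : ℕ, z ≠ -n) :
    DifferentiableAt ℂ Complex.digamma z ∧ DifferentiableAt ℂ trigamma z := by
  have ha : AnalyticAt ℂ Complex.Gamma z :=
    DifferentiableOn.analyticAt (s := {z : ℂ | ∀ n : ℕ, z ≠ -n})
      (fun w hw => (Complex.differentiableAt_Gamma w hw).differentiableWithinAt)
      (isOpen_setOf_ne_neg_natCast.mem_nhds hz)
  have hd : AnalyticAt ℂ Complex.digamma z := ha.deriv.div ha (Complex.Gamma_ne_zero hz)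
  exact ⟨hd.differentiableAt, hd.deriv.differentiableAt⟩

lemma ne_neg_natCast_of_re_pos {z : ℂ} (hz : 0 < z.re) (n : ℕ) : z ≠ -n := by
  rintro rfl
  simp at hz
  have : (0 : ℝ) ≤ n := n.cast_nonneg
  linarith

/-- Cauchy's estimate on discs of radius `1/2`, which stay inside `Re ≥ 1/2`, where digamma has
linear growth. -/
lemma norm_trigamma_le : ∃ C : ℝ, 0 ≤ C ∧ ∀ z : ℂ, 1 ≤ z.re →
    ‖trigamma z‖ ≤ C * (1 + ‖z‖) := by
  obtain ⟨C, hC, h⟩ := norm_digamma_le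
  refine ⟨4 * C, by positivity, fun z hz => ?_⟩
  have hre : ∀ w ∈ Metric.closedBall z (1 / 2), 1 / 2 ≤ w.re := by
    intro w hw
    have h1 := (Complex.abs_re_le_norm (w - z)).trans (mem_closedBall_iff_norm.1 hw)
    have := (abs_le.1 h1).1
    simp at this
    linarith
  have hd : DiffContOnCl ℂ Complex.digamma (Metric.ball z (1 / 2)) := by
    refine DifferentiableOn.diffContOnCl fun w hw => ?_
    rw [closure_ball _ (by norm_num)] at hw
    exact (differentiableAt_digamma (ne_neg_natCast_of_re_pos
      (by linarith [hre w hw]))).1.differentiableWithinAt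
  have h2 := Complex.norm_deriv_le_of_forall_mem_sphere_norm_le (c := z) (R := 1 / 2)
    (C := C * (1 + (‖z‖ + 1 / 2))) (by norm_num) hd fun w hw => by
      refine (h w (hre w (Metric.sphere_subset_closedBall hw))).trans ?_
      have : ‖w‖ ≤ ‖z‖ + 1 / 2 := by
        have := norm_le_norm_add_norm_sub' w z
        rwa [mem_sphere_iff_norm.1 hw] at this
      gcongr
  refine h2.trans ?_
  have := norm_nonneg z
  nlinarith

/-! ### Recurrence and duplication formulas. -/

lemma trigamma_add_one {z : ℂ} (hz : ∀ n : ℕ, z ≠ -n) :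
    trigamma (z + 1) = trigamma z - 1 / z ^ 2 := by
  have h0 : z ≠ 0 := by simpa using hz 0
  have hev : (fun w => Complex.digamma (w + 1)) =ᶠ[𝓝 z] fun w => Complex.digamma w + w⁻¹ := by
    filter_upwards [isOpen_setOf_ne_neg_natCast.mem_nhds hz] with w hw
    exact Complex.digamma_apply_add_one w hw
  have h1 := hev.deriv_eq
  have h2 := ((differentiableAt_digamma hz).1.hasDerivAt.add (hasDerivAt_inv h0)).deriv
  rw [deriv_comp_add_const] at h1
  rw [trigamma, h1, trigamma]
  refine Eq.trans h2 ?_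
  ring

lemma ne_neg_natCast_of_two_mul {z : ℂ} (hz : ∀ n : ℕ, 2 * z ≠ -n) :
    (∀ n : ℕ, z ≠ -n) ∧ ∀ n : ℕ, z + 1 / 2 ≠ -n :=
  ⟨fun n h => hz (2 * n) (by push_cast; linear_combination 2 * h),
    fun n h => hz (2 * n + 1) (by push_cast; linear_combination 2 * h)⟩

/-- Logarithmic derivative of Legendre's duplication formula. -/
lemma digamma_add_digamma_add_half {z : ℂ} (hz : ∀ n : ℕ, 2 * z ≠ -n) :
    Complex.digamma z + Complex.digamma (z + 1 / 2) =
      2 * Complex.digamma (2 * z) - 2 * Complex.log 2 := by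
  obtain ⟨h1, h2⟩ := ne_neg_natCast_of_two_mul hz
  have g1 := Complex.Gamma_ne_zero h1
  have g2 := Complex.Gamma_ne_zero h2
  have g3 := Complex.Gamma_ne_zero hz
  have d1 := (Complex.differentiableAt_Gamma _ h1).hasDerivAt
  have d2 : HasDerivAt (fun w : ℂ => Complex.Gamma (w + 1 / 2)) (deriv Complex.Gamma (z + 1 / 2)) z :=
    HasDerivAt.comp_add_const z (1 / 2) (Complex.differentiableAt_Gamma _ h2).hasDerivAt
  have l2 : HasDerivAt (fun w : ℂ => 2 * w) 2 z := by
    simpa using (hasDerivAt_id z).const_mul (2 : ℂ)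
  have d3 : HasDerivAt (fun w : ℂ => Complex.Gamma (2 * w)) (deriv Complex.Gamma (2 * z) * 2) z :=
    (Complex.differentiableAt_Gamma _ hz).hasDerivAt.comp z l2
  have d4 : HasDerivAt (fun w : ℂ => (2 : ℂ) ^ (1 - 2 * w))
      ((2 : ℂ) ^ (1 - 2 * z) * Complex.log 2 * -2) z :=
    (l2.const_sub 1).const_cpow (Or.inl two_ne_zero)
  have e1 : HasDerivAt (fun w => Complex.Gamma w * Complex.Gamma (w + 1 / 2)) _ z := d1.mul d2
  have e2 : HasDerivAt (fun w => Complex.Gamma (2 * w) * (2 : ℂ) ^ (1 - 2 * w) * (√Real.pi : ℝ)) _ z :=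
    (d3.mul d4).mul_const _
  simp only [Complex.Gamma_mul_Gamma_add_half] at e1
  have e := e1.unique e2
  have hm := Complex.Gamma_mul_Gamma_add_half z
  have hp : (2 : ℂ) ^ (1 - 2 * z) ≠ 0 := by simp [Complex.cpow_eq_zero_iff]
  have hs : ((√Real.pi : ℝ) : ℂ) ≠ 0 := by
    exact_mod_cast (Real.sqrt_pos.2 Real.pi_pos).ne'
  simp only [Complex.digamma_def, logDeriv_apply]
  rw [div_add_div _ _ g1 g2, div_eq_iff (mul_ne_zero g1 g2), e, hm]
  field_simp
  ring

lemma trigamma_add_trigamma_add_half {z : ℂ} (hz : ∀ n : ℕ, 2 * z ≠ -n) :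
    trigamma z + trigamma (z + 1 / 2) = 4 * trigamma (2 * z) := by
  obtain ⟨h1, h2⟩ := ne_neg_natCast_of_two_mul hz
  have l2 : HasDerivAt (fun w : ℂ => 2 * w) 2 z := by
    simpa using (hasDerivAt_id z).const_mul (2 : ℂ)
  have hev : (fun w => Complex.digamma w + Complex.digamma (w + 1 / 2)) =ᶠ[𝓝 z]
      fun w => 2 * Complex.digamma (2 * w) - 2 * Complex.log 2 := by
    filter_upwards [l2.continuousAt.preimage_mem_nhds
      (isOpen_setOf_ne_neg_natCast.mem_nhds hz)] with w hw
    exact digamma_add_digamma_add_half hw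
  have d1 := (differentiableAt_digamma h1).1.hasDerivAt
  have d2 : HasDerivAt (fun w : ℂ => Complex.digamma (w + 1 / 2)) (trigamma (z + 1 / 2)) z :=
    HasDerivAt.comp_add_const z (1 / 2) (differentiableAt_digamma h2).1.hasDerivAt
  have d3 : HasDerivAt (fun w : ℂ => Complex.digamma (2 * w)) (trigamma (2 * z) * 2) z :=
    (differentiableAt_digamma hz).1.hasDerivAt.comp z l2
  have e1 : HasDerivAt (fun w => Complex.digamma w + Complex.digamma (w + 1 / 2)) _ z := d1.add d2
  have e2 : HasDerivAt (fun w => 2 * Complex.digamma (2 * w) - 2 * Complex.log 2) _ z :=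
    (d3.const_mul 2).sub_const _
  have := (e1.congr_of_eventuallyEq hev.symm).unique e2
  rw [trigamma, this]
  ring

/-! ### Liouville-type theorems for periodic functions. -/

/-- An entire function of sublinear growth away from a disc is constant. -/
lemma Differentiable.eq_of_norm_le_rpow {f : ℂ → ℂ} (hf : Differentiable ℂ f) {C θ : ℝ}
    (hθ : θ < 1) (hb : ∀ z, 1 ≤ ‖z‖ → ‖f z‖ ≤ C * ‖z‖ ^ θ) (z w : ℂ) : f z = f w := by
  have hd : Differentiable ℂ (dslope f w) := by
    have := (Complex.differentiableOn_dslope (f := f) (s := Set.univ) (c := w) univ_mem).2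
      hf.differentiableOn
    exact differentiableOn_univ.1 this
  -- The divided difference is entire and tends to zero at infinity, so it vanishes identically by
  -- Liouville.
  have ht : Tendsto (dslope f w) (cocompact ℂ) (𝓝 0) := by
    rw [← Metric.cobounded_eq_cocompact]
    have hn : Tendsto (fun z : ℂ => ‖z‖) (Bornology.cobounded ℂ) atTop := tendsto_norm_cobounded_atTop
    have h1 : Tendsto (fun x : ℝ => 2 * (C * x ^ (-(1 - θ)) + ‖f w‖ * x⁻¹)) atTop (𝓝 0) := by
      simpa using (((tendsto_rpow_neg_atTop (sub_pos.2 hθ)).const_mul C).add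
        (tendsto_inv_atTop_zero.const_mul ‖f w‖)).const_mul 2
    refine squeeze_zero_norm' ?_ (h1.comp hn)
    filter_upwards [hn.eventually_ge_atTop 1, hn.eventually_gt_atTop (2 * ‖w‖)] with z hz1 hz2
    have hne : z ≠ w := by
      rintro rfl
      linarith
    have hpos : 0 < ‖z‖ := by linarith
    rw [dslope_of_ne _ hne, slope_def_field, norm_div]
    have h2 : ‖z‖ / 2 ≤ ‖z - w‖ := by linarith [norm_sub_norm_le z w]
    have h3 : ‖f z - f w‖ ≤ C * ‖z‖ ^ θ + ‖f w‖ := (norm_sub_le _ _).trans (by gcongr; exact hb z hz1)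
    have h4 : ‖z‖ ^ (-(1 - θ)) = ‖z‖ ^ θ / ‖z‖ := by
      rw [neg_sub, Real.rpow_sub hpos, Real.rpow_one]
    calc ‖f z - f w‖ / ‖z - w‖ ≤ (C * ‖z‖ ^ θ + ‖f w‖) / (‖z‖ / 2) := by
          gcongr
          exact (norm_nonneg _).trans h3
      _ = 2 * (C * ‖z‖ ^ (-(1 - θ)) + ‖f w‖ * ‖z‖⁻¹) := by
          rw [h4]
          field_simp
  have h0 := hd.apply_eq_of_tendsto_cocompact z ht
  have := sub_smul_dslope f w z
  rw [h0, smul_zero] at this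
  exact sub_eq_zero.1 this.symm

/-- A `1`-periodic entire function of exponential type less than `2π` is constant. -/
lemma Differentiable.eq_of_periodic_of_norm_le_exp {f : ℂ → ℂ} (hf : Differentiable ℂ f)
    (hper : Function.Periodic f 1) {C K : ℝ} (hK : K < 2 * Real.pi)
    (hb : ∀ z, ‖f z‖ ≤ C * Real.exp (K * |z.im|)) (z w : ℂ) : f z = f w := by
  have hpi := Real.pi_pos
  set q := Function.Periodic.qParam 1 with hq
  have hqn : ∀ z : ℂ, ‖q z‖ = Real.exp (-(2 * Real.pi * z.im)) := by
    intro z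
    rw [hq, Function.Periodic.norm_qParam]
    congr 1
    ring
  have hqper : Function.Periodic q 1 := by
    intro z
    simp only [hq, Function.Periodic.qParam]
    rw [show 2 * (Real.pi : ℂ) * Complex.I * (z + 1) / (1 : ℝ) =
      2 * Real.pi * Complex.I * z / (1 : ℝ) + 2 * Real.pi * Complex.I by push_cast; ring,
      Complex.exp_periodic]
  -- The growth bound does not exclude a pole of `f` at `q = 0`, but as `K < 2π` the product `q f`
  -- tends to zero there. Dividing its extension by `q` again gives an entire function of `q`.
  set u : ℂ → ℂ := fun z => q z * f z with hu
  have hud : Differentiable ℂ u := Function.Periodic.differentiable_qParam.mul hf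
  have huper : Function.Periodic u ((1 : ℝ) : ℂ) := by
    intro z
    simp only [hu, Complex.ofReal_one, hper z, hqper z]
  have hzero : ZeroAtFilter (comap Complex.im atTop) u := by
    have h1 : Tendsto (fun y : ℝ => C * Real.exp ((K - 2 * Real.pi) * y)) atTop (𝓝 0) := by
      have : Tendsto (fun y : ℝ => (K - 2 * Real.pi) * y) atTop atBot :=
        tendsto_id.const_mul_atTop_of_neg (by linarith)
      simpa using (Real.tendsto_exp_atBot.comp this).const_mul C
    refine squeeze_zero_norm' ?_ (h1.comp tendsto_comap)
    filter_upwards [tendsto_comap.eventually (eventually_ge_atTop 0)] with z hz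
    have h2 := hb z
    rw [abs_of_nonneg hz] at h2
    simp only [hu, norm_mul, hqn, Function.comp]
    calc Real.exp (-(2 * Real.pi * z.im)) * ‖f z‖
        ≤ Real.exp (-(2 * Real.pi * z.im)) * (C * Real.exp (K * z.im)) := by gcongr
      _ = C * Real.exp ((K - 2 * Real.pi) * z.im) := by
          rw [mul_left_comm, ← Real.exp_add]
          ring_nf
  set U := Function.Periodic.cuspFunction 1 u with hU
  have hU0 : U 0 = 0 := Function.Periodic.cuspFunction_zero_of_zero_at_inf one_pos hzero
  have hUq : ∀ z, U (q z) = q z * f z := fun z =>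
    Function.Periodic.eq_cuspFunction one_ne_zero huper z
  have hsurj : ∀ v : ℂ, v ≠ 0 → ∃ z, q z = v := fun v hv =>
    ⟨_, Function.Periodic.qParam_right_inv one_ne_zero hv⟩
  have hUd : Differentiable ℂ U := by
    intro v
    rcases eq_or_ne v 0 with rfl | hv
    · exact Function.Periodic.differentiableAt_cuspFunction_zero one_pos huper
        (Eventually.of_forall fun z => hud z) hzero.boundedAtFilter
    · obtain ⟨z, rfl⟩ := hsurj v hv
      exact Function.Periodic.differentiableAt_cuspFunction one_ne_zero huper (hud z)
  have hVd : Differentiable ℂ (dslope U 0) := by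
    have := (Complex.differentiableOn_dslope (f := U) (s := Set.univ) (c := 0) univ_mem).2
      hUd.differentiableOn
    exact differentiableOn_univ.1 this
  have hVq : ∀ z, dslope U 0 (q z) = f z := by
    intro z
    have hz : q z ≠ 0 := Function.Periodic.qParam_ne_zero z
    rw [dslope_of_ne _ hz, slope_def_field, hU0, hUq, sub_zero, sub_zero, mul_div_cancel_left₀ _ hz]
  rw [← hVq z, ← hVq w]
  -- For `|q| ≥ 1` one has `Im z ≤ 0` and `exp (K |Im z|) = |q| ^ (K / 2π)`, with exponent below
  -- one.
  refine hVd.eq_of_norm_le_rpow (C := C) (θ := K / (2 * Real.pi))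
    ((div_lt_one (by positivity)).2 hK) (fun v hv => ?_) _ _
  obtain ⟨z, rfl⟩ := hsurj v (norm_pos_iff.1 (by linarith))
  rw [hqn, Real.one_le_exp_iff] at hv
  have him : z.im ≤ 0 := by
    by_contra h
    have := mul_pos (mul_pos two_pos hpi) (not_le.1 h)
    linarith
  rw [hVq, hqn, ← Real.exp_mul]
  have := hb z
  rw [abs_of_nonpos him] at this
  convert this using 3
  field_simp

/-- A function which is holomorphic and `1`-periodic on the right half plane, and of exponential
type less than `2π` on a strip, is constant on this strip. -/
lemma eq_of_add_one_of_norm_le_exp {f : ℂ → ℂ} (hf : ∀ z : ℂ, 0 < z.re → DifferentiableAt ℂ f z)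
    (hper : ∀ z : ℂ, 0 < z.re → f (z + 1) = f z) {C K : ℝ} (hK : K < 2 * Real.pi)
    (hb : ∀ z : ℂ, 1 ≤ z.re → z.re ≤ 2 → ‖f z‖ ≤ C * Real.exp (K * |z.im|))
    {z w : ℂ} (hz : 1 ≤ z.re) (hz2 : z.re < 2) (hw : 1 ≤ w.re) (hw2 : w.re < 2) : f z = f w := by
  set F : ℂ → ℂ := fun z => f (z - (⌊z.re⌋ : ℂ) + 1) with hF
  have hFper : Function.Periodic F 1 := by
    intro z
    simp only [hF, Complex.add_re, Complex.one_re, Int.floor_add_one]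
    push_cast
    ring_nf
  have hre : ∀ z : ℂ, (z - (⌊z.re⌋ : ℂ) + 1).re = Int.fract z.re + 1 := by
    intro z
    rw [← Int.self_sub_floor]
    simp
  have hFb : ∀ z, ‖F z‖ ≤ C * Real.exp (K * |z.im|) := by
    intro z
    have h1 := Int.fract_nonneg z.re
    have h2 := (Int.fract_lt_one z.re).le
    have := hb (z - (⌊z.re⌋ : ℂ) + 1) (by rw [hre]; linarith) (by rw [hre]; linarith)
    simpa using this
  have hFd : Differentiable ℂ F := by
    intro z
    -- One formula valid on both sides of an integer line: to its left the floor drops by one, to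
    -- its right periodicity of `f` supplies the extra shift.
    have hev : F =ᶠ[𝓝 z] fun w => f (w - (⌊z.re⌋ : ℂ) + 2) := by
      have h1 : ∀ᶠ w : ℂ in 𝓝 z, w.re ∈ Set.Ioo ((⌊z.re⌋ : ℝ) - 1) (⌊z.re⌋ + 1) :=
        Complex.continuous_re.continuousAt.eventually_mem (Ioo_mem_nhds
          (by linarith [Int.floor_le z.re]) (Int.lt_floor_add_one z.re))
      filter_upwards [h1] with w ⟨hw1, hw2⟩
      rcases lt_or_ge w.re ⌊z.re⌋ with h | h
      · have : ⌊w.re⌋ = ⌊z.re⌋ - 1 := by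
          rw [Int.floor_eq_iff]
          push_cast
          constructor <;> linarith
        simp only [hF, this]
        congr 1
        push_cast
        ring
      · have : ⌊w.re⌋ = ⌊z.re⌋ := by
          rw [Int.floor_eq_iff]
          constructor <;> linarith
        simp only [hF, this]
        rw [← hper]
        · congr 1
          ring
        · simp
          linarith
    refine DifferentiableAt.congr_of_eventuallyEq ?_ hev
    have hpos : 0 < (z - (⌊z.re⌋ : ℂ) + 2).re := by
      have := Int.fract_nonneg z.re
      simp
      linarith
    exact DifferentiableAt.comp z (g := f) (hf _ hpos) (by fun_prop)
  have hFeq : ∀ z : ℂ, 1 ≤ z.re → z.re < 2 → F z = f z := by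
    intro z h1 h2
    have : ⌊z.re⌋ = 1 := by
      rw [Int.floor_eq_iff]
      push_cast
      constructor <;> linarith
    simp [hF, this]
  rw [← hFeq z hz hz2, ← hFeq w hw hw2]
  exact hFd.eq_of_periodic_of_norm_le_exp hFper hK hFb z w

/-! ### The closed form: difference equation and growth. -/

/-- The closed form of `logSum a`. -/
noncomputable def logSumClosed (a : ℂ) : ℂ :=
  -2 * Real.eulerMascheroniConstant - 2 * Complex.digamma (a + 1)
    + (trigamma ((a + 1) / 2) - 2 * trigamma (a + 1)) * (Complex.sin (Real.pi * a) / Real.pi)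
    + 1 / a - Complex.sin (Real.pi * a) / (Real.pi * a ^ 2)

lemma add_one_ne_neg_natCast {a : ℂ} (ha : ∀ n : ℕ, a ≠ -n) (n : ℕ) : a + 1 ≠ -n :=
  fun h => ha (n + 1) (by push_cast; linear_combination h)

lemma add_one_ne_zero_of_ne_neg_natCast {a : ℂ} (ha : ∀ n : ℕ, a ≠ -n) : a + 1 ≠ 0 :=
  fun h => ha 1 (by push_cast; linear_combination h)

lemma ne_zero_of_ne_neg_natCast {a : ℂ} (ha : ∀ n : ℕ, a ≠ -n) : a ≠ 0 := by simpa using ha 0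

lemma half_ne_neg_natCast {a : ℂ} (ha : ∀ n : ℕ, a ≠ -n) (n : ℕ) : a / 2 ≠ -n :=
  fun h => ha (2 * n) (by push_cast; linear_combination 2 * h)

lemma sin_pi_mul_add_one (a : ℂ) :
    Complex.sin (Real.pi * (a + 1)) = -Complex.sin (Real.pi * a) := by
  rw [mul_add, mul_one, Complex.sin_add_pi]

lemma ofReal_pi_ne_zero : (Real.pi : ℂ) ≠ 0 := by exact_mod_cast Real.pi_ne_zero

/-- By duplication and recurrence, `trigamma (x/2) - 2 trigamma x` changes sign under `x ↦ x + 1` up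
to the term `2 / x²`. The sine changes sign too, so their product is periodic up to elementary
terms. -/
lemma logSumClosed_add_one {a : ℂ} (ha : ∀ n : ℕ, a ≠ -n) :
    logSumClosed (a + 1) = logSumClosed a + (Complex.sin (Real.pi * a) / (Real.pi * a) - 1) / a
      + (Complex.sin (Real.pi * (a + 1)) / (Real.pi * (a + 1)) - 1) / (a + 1) := by
  have h0 := ne_zero_of_ne_neg_natCast ha
  have h1 := add_one_ne_zero_of_ne_neg_natCast ha
  have ha1 := add_one_ne_neg_natCast ha
  have t1 := trigamma_add_one ha1
  have t2 := trigamma_add_trigamma_add_half (z := (a + 1) / 2)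
    (fun n => by rw [mul_div_cancel₀ _ two_ne_zero]; exact ha1 n)
  rw [mul_div_cancel₀ _ two_ne_zero, show (a + 1) / 2 + 1 / 2 = (a + 1 + 1) / 2 by ring] at t2
  have hpi := ofReal_pi_ne_zero
  rw [logSumClosed, logSumClosed, sin_pi_mul_add_one, Complex.digamma_apply_add_one _ ha1, t1,
    eq_sub_of_add_eq' t2]
  field_simp
  ring

lemma logSumClosed_one : logSumClosed 1 = -1 := by
  have h := Complex.digamma_apply_add_one 1 (fun n => ne_neg_natCast_of_re_pos (by simp) n)
  rw [logSumClosed, h, Complex.digamma_one, mul_one, Complex.sin_pi]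
  simp
  ring

lemma differentiableAt_logSumClosed {a : ℂ} (ha : ∀ n : ℕ, a ≠ -n) :
    DifferentiableAt ℂ logSumClosed a := by
  have h0 := ne_zero_of_ne_neg_natCast ha
  have ha1 := add_one_ne_neg_natCast ha
  have d1 : DifferentiableAt ℂ (fun a : ℂ => Complex.digamma (a + 1)) a :=
    DifferentiableAt.comp a (g := Complex.digamma) (differentiableAt_digamma ha1).1 (by fun_prop)
  have d2 : DifferentiableAt ℂ (fun a : ℂ => trigamma (a + 1)) a :=
    DifferentiableAt.comp a (g := trigamma) (differentiableAt_digamma ha1).2 (by fun_prop)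
  have d3 : DifferentiableAt ℂ (fun a : ℂ => trigamma ((a + 1) / 2)) a :=
    DifferentiableAt.comp a (g := trigamma)
      (differentiableAt_digamma (half_ne_neg_natCast ha1)).2 (by fun_prop)
  have h2 : (Real.pi : ℂ) * a ^ 2 ≠ 0 := mul_ne_zero ofReal_pi_ne_zero (pow_ne_zero 2 h0)
  unfold logSumClosed
  fun_prop (disch := assumption)

lemma norm_sin_pi_mul_le (a : ℂ) :
    ‖Complex.sin (Real.pi * a)‖ ≤ Real.exp (Real.pi * |a.im|) := by
  have hpi := Real.pi_pos.le
  have h1 : ‖Complex.exp (-(Real.pi * a) * Complex.I)‖ ≤ Real.exp (Real.pi * |a.im|) := by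
    rw [Complex.norm_exp]
    simp
    gcongr
    exact le_abs_self _
  have h2 : ‖Complex.exp (Real.pi * a * Complex.I)‖ ≤ Real.exp (Real.pi * |a.im|) := by
    rw [Complex.norm_exp]
    simp
    rw [← mul_neg]
    gcongr
    exact neg_le_abs _
  rw [Complex.sin, norm_div, norm_mul, Complex.norm_I, mul_one, Complex.norm_ofNat]
  have := norm_sub_le (Complex.exp (-(Real.pi * a) * Complex.I))
    (Complex.exp (Real.pi * a * Complex.I))
  linarith

/-- On the strip `‖a‖ ≤ 2 + |Im a|`, and the linear factor is absorbed into `exp |Im a|`, whence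
type `π + 1`. -/
lemma norm_logSum_le_of_re_le : ∃ C : ℝ, ∀ a : ℂ, 1 ≤ a.re → a.re ≤ 2 →
    ‖logSum a‖ ≤ C * Real.exp ((Real.pi + 1) * |a.im|) := by
  obtain ⟨S, hS⟩ : ∃ S, S = ∑' n : ℕ, 1 / ((n : ℝ) + 1) ^ 2 := ⟨_, rfl⟩
  have hS0 : 0 ≤ S := hS ▸ tsum_nonneg fun n => by positivity
  refine ⟨2 * Real.exp (2 * Real.pi) * S, fun a h1 h2 => ?_⟩
  have h3 := norm_logSum_le a
  rw [← hS] at h3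
  have hpi := Real.pi_pos.le
  have h4 : ‖a‖ ≤ 2 + |a.im| := by
    refine (Complex.norm_le_abs_re_add_abs_im a).trans ?_
    rw [abs_of_nonneg (by linarith)]
    linarith
  have h5 : 2 + |a.im| ≤ 2 * Real.exp |a.im| := by
    linarith [Real.add_one_le_exp |a.im|, abs_nonneg a.im]
  calc ‖logSum a‖ ≤ ‖a‖ * Real.exp (Real.pi * ‖a‖) * S := h3
    _ ≤ (2 * Real.exp |a.im|) * Real.exp (Real.pi * (2 + |a.im|)) * S := by
        gcongr
        exact h4.trans h5
    _ = 2 * Real.exp (2 * Real.pi) * S * Real.exp ((Real.pi + 1) * |a.im|) := by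
        have : Real.exp |a.im| * Real.exp (Real.pi * (2 + |a.im|)) =
            Real.exp (2 * Real.pi) * Real.exp ((Real.pi + 1) * |a.im|) := by
          rw [← Real.exp_add, ← Real.exp_add]
          ring_nf
        linear_combination 2 * S * this

lemma norm_logSumClosed_le_of_re_le : ∃ C : ℝ, ∀ a : ℂ, 1 ≤ a.re → a.re ≤ 2 →
    ‖logSumClosed a‖ ≤ C * Real.exp ((Real.pi + 1) * |a.im|) := by
  obtain ⟨A, hA, hdi⟩ := norm_digamma_le
  obtain ⟨B, hB, htri⟩ := norm_trigamma_le
  -- Here `4` collects `2` for Euler's constant and `1` each for the last two terms; `8 A` is two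
  -- digammas and `12 B` three trigammas, each bounded by `4 E` times `A` or `B`.
  refine ⟨4 + 8 * A + 12 * B, fun a h1 h2 => ?_⟩
  have hy := abs_nonneg a.im
  have hg := Real.eulerMascheroniConstant_lt_two_thirds
  have hg' := Real.one_half_lt_eulerMascheroniConstant
  have hpi := Real.pi_gt_three
  have hn1 : 1 ≤ ‖a‖ := h1.trans (Complex.re_le_norm a)
  have h4 : ‖a + 1‖ ≤ 3 + |a.im| := by
    refine (Complex.norm_le_abs_re_add_abs_im _).trans ?_
    rw [abs_of_nonneg (by simp; linarith)]
    simp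
    linarith
  set E := Real.exp |a.im|
  set P := Real.exp (Real.pi * |a.im|)
  have hE : 1 + |a.im| ≤ E := by linarith [Real.add_one_le_exp |a.im|]
  have hP : 1 ≤ P := Real.one_le_exp (by positivity)
  have hPE : Real.exp ((Real.pi + 1) * |a.im|) = P * E := by
    rw [← Real.exp_add]
    ring_nf
  have hs : ‖Complex.sin (Real.pi * a)‖ ≤ P := norm_sin_pi_mul_le a
  have hpin : ‖(Real.pi : ℂ)‖ = Real.pi := by simp [abs_of_pos Real.pi_pos]
  have e1 : ‖Complex.digamma (a + 1)‖ ≤ A * (4 * E) := by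
    refine (hdi _ (by simp; linarith)).trans ?_
    gcongr
    linarith
  have e2 : ‖trigamma (a + 1)‖ ≤ B * (4 * E) := by
    refine (htri _ (by simp; linarith)).trans ?_
    gcongr
    linarith
  have e3 : ‖trigamma ((a + 1) / 2)‖ ≤ B * (4 * E) := by
    refine (htri _ (by simp; linarith)).trans ?_
    have : ‖(a + 1) / 2‖ ≤ ‖a + 1‖ := by
      rw [norm_div, Complex.norm_ofNat]
      linarith [norm_nonneg (a + 1)]
    gcongr
    linarith
  have e4 : ‖Complex.sin (Real.pi * a) / Real.pi‖ ≤ P := by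
    rw [norm_div, hpin]
    exact (div_le_self (norm_nonneg _) (by linarith)).trans hs
  have e5 : ‖1 / a‖ ≤ 1 := by
    rw [norm_div, norm_one]
    exact (div_le_one (by linarith)).2 hn1
  have e6 : ‖Complex.sin (Real.pi * a) / (Real.pi * a ^ 2)‖ ≤ P := by
    rw [norm_div, norm_mul, norm_pow, hpin]
    refine (div_le_self (norm_nonneg _) ?_).trans hs
    nlinarith [one_le_pow₀ hn1 (n := 2)]
  have e7 : ‖trigamma ((a + 1) / 2) - 2 * trigamma (a + 1)‖ ≤ 12 * B * E := by
    refine (norm_sub_le _ _).trans ?_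
    rw [norm_mul, Complex.norm_ofNat]
    linarith
  have e8 : ‖(trigamma ((a + 1) / 2) - 2 * trigamma (a + 1)) *
      (Complex.sin (Real.pi * a) / Real.pi)‖ ≤ 12 * B * E * P := by
    rw [norm_mul]
    gcongr
  have e9 : ‖(-2 * Real.eulerMascheroniConstant : ℂ)‖ ≤ 2 := by
    rw [norm_mul, norm_neg, Complex.norm_ofNat, Complex.norm_real, Real.norm_eq_abs,
      abs_of_pos (by linarith)]
    linarith
  have e10 : ‖2 * Complex.digamma (a + 1)‖ ≤ 8 * A * E := by
    rw [norm_mul, Complex.norm_ofNat]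
    linarith
  rw [hPE, logSumClosed]
  have t1 := norm_sub_le (-2 * Real.eulerMascheroniConstant - 2 * Complex.digamma (a + 1)
    + (trigamma ((a + 1) / 2) - 2 * trigamma (a + 1)) * (Complex.sin (Real.pi * a) / Real.pi)
    + 1 / a) (Complex.sin (Real.pi * a) / (Real.pi * a ^ 2))
  have t2 := norm_add_le (-2 * Real.eulerMascheroniConstant - 2 * Complex.digamma (a + 1)
    + (trigamma ((a + 1) / 2) - 2 * trigamma (a + 1)) * (Complex.sin (Real.pi * a) / Real.pi))
    (1 / a)
  have t3 := norm_add_le (-2 * Real.eulerMascheroniConstant - 2 * Complex.digamma (a + 1))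
    ((trigamma ((a + 1) / 2) - 2 * trigamma (a + 1)) * (Complex.sin (Real.pi * a) / Real.pi))
  have t4 := norm_sub_le (-2 * Real.eulerMascheroniConstant : ℂ) (2 * Complex.digamma (a + 1))
  have hE1 : 1 ≤ E := by linarith
  have m1 : P ≤ P * E := le_mul_of_one_le_right (by linarith) hE1
  have m2 : A * E ≤ A * (P * E) := by
    gcongr
    exact le_mul_of_one_le_left (by linarith) hP
  nlinarith

/-! ### Identification of `logSum` with its closed form. -/

lemma logSum_eq {a : ℂ} (ha : ∀ n : ℕ, a ≠ -n) : logSum a = logSumClosed a := by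
  set h : ℂ → ℂ := fun a => logSum a - logSumClosed a with hh
  have hper : ∀ a : ℂ, (∀ n : ℕ, a ≠ -n) → h (a + 1) = h a := by
    intro a ha
    simp only [hh]
    rw [logSumClosed_add_one ha, logSum_add_one (ne_zero_of_ne_neg_natCast ha)
      (add_one_ne_zero_of_ne_neg_natCast ha)]
    ring
  obtain ⟨A, hA⟩ := norm_logSum_le_of_re_le
  obtain ⟨B, hB⟩ := norm_logSumClosed_le_of_re_le
  have hstrip : ∀ z : ℂ, 1 ≤ z.re → z.re < 2 → h z = 0 := by
    intro z h1 h2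
    have h3 : h 1 = 0 := by simp [hh, logSum_one, logSumClosed_one]
    rw [← h3]
    -- Admissible because `π + 1 < 2π`.
    refine eq_of_add_one_of_norm_le_exp (C := A + B) (K := Real.pi + 1)
      (fun z hz => (differentiable_logSum z).sub
        (differentiableAt_logSumClosed (ne_neg_natCast_of_re_pos hz)))
      (fun z hz => hper z (ne_neg_natCast_of_re_pos hz))
      (by linarith [Real.pi_gt_three]) (fun z hz1 hz2 => ?_) h1 h2 (by simp) (by simp)
    refine (norm_sub_le _ _).trans ?_
    rw [add_mul]
    exact add_le_add (hA z hz1 hz2) (hB z hz1 hz2)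
  -- Integer shifts carry the vanishing from the strip to every admissible `a`.
  have hadd : ∀ (N : ℕ) (a : ℂ), (∀ n : ℕ, a ≠ -n) → h (a + N) = h a := by
    intro N
    induction N with
    | zero => simp
    | succ N ih =>
      intro a ha
      rw [← hper a ha, ← ih (a + 1) (add_one_ne_neg_natCast ha)]
      push_cast
      ring_nf
  have hright : ∀ a : ℂ, 1 ≤ a.re → h a = 0 := by
    intro a h1
    have h2 : (1 : ℝ) ≤ ⌊a.re⌋₊ := by exact_mod_cast Nat.le_floor (by simpa using h1)
    have h3 := Nat.floor_le (by linarith : 0 ≤ a.re)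
    have h4 := Nat.lt_floor_add_one a.re
    obtain ⟨m, hm⟩ := Nat.exists_eq_add_of_le' (show 1 ≤ ⌊a.re⌋₊ by exact_mod_cast h2)
    rw [hm] at h3 h4
    push_cast at h3 h4
    have h5 := hstrip (a - m) (by simp; linarith) (by simp; linarith)
    rw [← hadd m (a - m) (ne_neg_natCast_of_re_pos (by simp; linarith)), sub_add_cancel] at h5
    exact h5
  have h0 : h a = 0 := by
    obtain ⟨N, hN⟩ := exists_nat_ge (1 - a.re)
    rw [← hadd N a ha]
    exact hright _ (by simp; linarith)
  exact sub_eq_zero.1 h0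

/-! ### The parameters `b = -a - m`. -/

lemma quadDecay_neg_sub (a : ℂ) (m : ℕ) : QuadDecay a (-a - m) := by
  induction m with
  | zero => simpa using quadDecay_neg a
  | succ m ih =>
    have := ih.sub_one
    rwa [sub_sub, ← Nat.cast_add_one] at this

lemma tsum_gaussTerm_neg_sub {a : ℂ} (ha : ∀ n : ℕ, a ≠ -n) (m : ℕ) :
    (a + m + 1) * ∑' n, gaussTerm a (-a - (m + 1 : ℕ)) n =
      (m + 1) * ∑' n, gaussTerm a (-a - m) n := by
  have hb : -a - (m : ℂ) ≠ 1 := fun h => ha (m + 1) (by push_cast; linear_combination -h)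
  have h := (quadDecay_neg_sub a m).tsum_gaussTerm_sub_one hb
  rw [sub_sub, ← Nat.cast_add_one] at h
  linear_combination h

lemma tsum_logTerm_neg_sub {a : ℂ} (ha : ∀ n : ℕ, a ≠ -n) (m : ℕ) :
    ∑' n, logTerm a (-a - (m + 1 : ℕ)) n = ∑' n, logTerm a (-a - m) n +
      1 / (a + m + 1) * (∑' n, gaussTerm a (-a - (m + 1 : ℕ)) n - 1) := by
  have hb : -a - (m : ℂ) ≠ 1 := fun h => ha (m + 1) (by push_cast; linear_combination -h)
  have hq : QuadDecay a (-a - m - 1) := by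
    have := quadDecay_neg_sub a (m + 1)
    rwa [Nat.cast_add_one, ← sub_sub] at this
  have h := (hq.tsum_logTerm_sub_one hb).2
  rw [sub_sub, ← Nat.cast_add_one,
    show (1 : ℂ) / (-a - (m + 1 : ℕ)) = -(1 / (a + m + 1)) by
      rw [← div_neg]; push_cast; ring_nf] at h
  linear_combination -h

lemma hasSum_hyp43Term {a : ℂ} (ha : ∀ n : ℕ, a ≠ -n) (m : ℕ) :
    Summable (hyp43Term 1 1 (a + 1) (1 - a - m) 2 2 2 1) ∧
      hyp43 1 1 (a + 1) (1 - a - m) 2 2 2 1 =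
        -(1 / (a * (a + m))) * ∑' n, logTerm a (-a - m) n := by
  have h0 := ne_zero_of_ne_neg_natCast ha
  have h1 : a + 1 ≠ 1 := fun h => h0 (by linear_combination h)
  have h2 : 1 - a - m ≠ 1 := fun h => ha m (by linear_combination -h)
  have h3 : hyp43Term 1 1 (a + 1) (1 - a - m) 2 2 2 1 =
      fun k => -(1 / (a * (a + m))) * logTerm a (-a - m) k := by
    ext k
    rw [hyp43Term_eq_logTerm h1 h2, add_sub_cancel_right,
      show 1 - a - (m : ℂ) - 1 = -a - m by ring, ← div_neg]
    ring_nf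
  have hs := (quadDecay_neg_sub a m).summable_logTerm
  rw [hyp43, h3]
  exact ⟨hs.mul_left _, tsum_mul_left⟩

/-! ### The Gamma quotient in the last closed form. -/

/-- The closed form of `₄F₃(1, 1, c, -1 - c; 2, 2, 2; 1)` without quotients of Gamma functions. -/
noncomputable def closedFormNegOneSubReduced (c : ℂ) : ℂ :=
  2 * ((Complex.digamma (3 + c) + (Real.eulerMascheroniConstant : ℂ)) / ((c - 1) * (c + 2)))
    - 2 * ((2 * c + 1) * (c ^ 2 + c - 1) / (c * (c + 1) * (c + 2) ^ 2 * (c - 1) ^ 2))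
    + Complex.sin (Real.pi * c) / (2 * Real.pi * c * (c + 2) * (c - 1) ^ 3) *
      (2 * c * (trigamma (c / 2) - 2 * trigamma c) * (c - 1) ^ 2
        + (-2 * c ^ 6 - 10 * c ^ 5 - 12 * c ^ 4 + 14 * c ^ 3 - 10 * c ^ 2 - 44 * c - 8)
          / ((c + 2) ^ 2 * c * (c + 1) ^ 2))

/-- Legendre duplication at `c + 1`, with `4 ^ c = 2 ^ (2c)`. -/
lemma Gamma_quotient_eq {c : ℂ} (hc : ∀ n : ℕ, c ≠ -n) (hc2 : ∀ n : ℕ, c ≠ -(3 / 2 : ℂ) - n) :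
    Complex.Gamma c * (4 : ℂ) ^ c * Complex.Gamma (3 / 2 + c) * (2 * c) =
      (Real.pi : ℂ) ^ (1 / 2 : ℂ) * Complex.Gamma (2 * c + 2) ∧ Complex.Gamma (2 * c + 2) ≠ 0 := by
  have hcc := ne_zero_of_ne_neg_natCast hc
  constructor
  · have h := Complex.Gamma_mul_Gamma_add_half (c + 1)
    have h4 : (4 : ℂ) ^ c = 2 ^ (2 * c) := by
      have := Complex.mul_cpow_ofReal_nonneg (a := 2) (b := 2) zero_le_two zero_le_two c
      rw [two_mul, Complex.cpow_add _ _ two_ne_zero]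
      push_cast at this
      rw [← this]
      norm_num
    have h5 : (2 : ℂ) ^ (2 * c) * 2 * 2 ^ (1 - 2 * (c + 1)) = 1 := by
      rw [mul_right_comm, ← Complex.cpow_add _ _ two_ne_zero,
        show 2 * c + (1 - 2 * (c + 1)) = -1 by ring, Complex.cpow_neg_one]
      norm_num
    have h6 : ((√Real.pi : ℝ) : ℂ) = (Real.pi : ℂ) ^ (1 / 2 : ℂ) := by
      rw [Real.sqrt_eq_rpow, Complex.ofReal_cpow Real.pi_pos.le]
      simp
    rw [Complex.Gamma_add_one _ hcc, show c + 1 + 1 / 2 = 3 / 2 + c by ring, h6,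
      show 2 * (c + 1) = 2 * c + 2 by ring] at h
    rw [show 2 * (c + 1) = 2 * c + 2 by ring] at h5
    rw [h4]
    linear_combination 2 ^ (2 * c) * 2 * h +
      Complex.Gamma (2 * c + 2) * (Real.pi : ℂ) ^ (1 / 2 : ℂ) * h5
  · refine Complex.Gamma_ne_zero fun n hn => ?_
    -- Even poles of `Γ(2c+2)` put `c` at a negative integer, odd ones at `-3/2 - k`.
    rcases Nat.even_or_odd' n with ⟨k, rfl | rfl⟩
    · exact hc (k + 1) (by push_cast at hn ⊢; linear_combination hn / 2)
    · exact hc2 k (by push_cast at hn ⊢; linear_combination hn / 2)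

lemma closedFormNegOneSub_eq_reduced {c : ℂ} (hc1 : c ≠ 1) (hc : ∀ n : ℕ, c ≠ -n)
    (hc2 : ∀ n : ℕ, c ≠ -(3 / 2 : ℂ) - n) :
    closedFormNegOneSub c = closedFormNegOneSubReduced c := by
  obtain ⟨h, hG⟩ := Gamma_quotient_eq hc hc2
  have h0 := ne_zero_of_ne_neg_natCast hc
  have h1 := sub_ne_zero.2 hc1
  have h2 : c + 2 ≠ 0 := fun h => hc 2 (by push_cast; linear_combination h)
  have hpi := ofReal_pi_ne_zero
  have hpi2 : (Real.pi : ℂ) ^ (1 / 2 : ℂ) ≠ 0 := by simp [Complex.cpow_eq_zero_iff, hpi]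
  have h32 : (Real.pi : ℂ) ^ (3 / 2 : ℂ) = Real.pi * (Real.pi : ℂ) ^ (1 / 2 : ℂ) := by
    rw [show (3 / 2 : ℂ) = 1 + 1 / 2 by norm_num, Complex.cpow_add _ _ hpi, Complex.cpow_one]
  have key : Complex.Gamma c * Complex.sin (Real.pi * c) * (4 : ℂ) ^ c * Complex.Gamma (3 / 2 + c)
        / ((Real.pi : ℂ) ^ (3 / 2 : ℂ) * (c + 2) * (c - 1) ^ 3 * Complex.Gamma (2 * c + 2)) =
      Complex.sin (Real.pi * c) / (2 * Real.pi * c * (c + 2) * (c - 1) ^ 3) := by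
    rw [h32, div_eq_div_iff (by simp [*]) (by simp [*])]
    linear_combination Complex.sin (Real.pi * c) * Real.pi * (c + 2) * (c - 1) ^ 3 * h
  rw [closedFormNegOneSub, closedFormNegOneSubReduced, key]

lemma continuousAt_closedFormNegOneSubReduced {c : ℂ} (hc1 : c ≠ 1) (hc : ∀ n : ℕ, c ≠ -n) :
    ContinuousAt closedFormNegOneSubReduced c := by
  have h0 := ne_zero_of_ne_neg_natCast hc
  have h1 := sub_ne_zero.2 hc1
  have h2 : c + 2 ≠ 0 := fun h => hc 2 (by push_cast; linear_combination h)
  have h3 := add_one_ne_zero_of_ne_neg_natCast hc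
  have hpi := ofReal_pi_ne_zero
  have k3 : ∀ n : ℕ, 3 + c ≠ -n := fun n h => hc (n + 3) (by push_cast; linear_combination h)
  have d1 : ContinuousAt (fun c : ℂ => Complex.digamma (3 + c)) c :=
    ContinuousAt.comp (g := Complex.digamma) (differentiableAt_digamma k3).1.continuousAt
      (by fun_prop)
  have d2 : ContinuousAt trigamma c := (differentiableAt_digamma hc).2.continuousAt
  have d3 : ContinuousAt (fun c : ℂ => trigamma (c / 2)) c :=
    ContinuousAt.comp (g := trigamma)
      (differentiableAt_digamma (half_ne_neg_natCast hc)).2.continuousAt (by fun_prop)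
  have n1 : (c - 1) * (c + 2) ≠ 0 := by simp [*]
  have n2 : c * (c + 1) * (c + 2) ^ 2 * (c - 1) ^ 2 ≠ 0 := by simp [*]
  have n3 : 2 * (Real.pi : ℂ) * c * (c + 2) * (c - 1) ^ 3 ≠ 0 := by simp [*]
  have n4 : (c + 2) ^ 2 * c * (c + 1) ^ 2 ≠ 0 := by simp [*]
  unfold closedFormNegOneSubReduced
  fun_prop (disch := assumption)

/-! ### Assembly of the four evaluations. -/

lemma closed_forms_eq {a : ℂ} (ha : ∀ n : ℕ, a ≠ -n) :
    hyp43 1 1 (a + 1) (1 - a) 2 2 2 1 = closedFormTwoSub (a + 1) ∧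
    hyp43 1 1 (a + 1) (-a) 2 2 2 1 = closedFormOneSub (a + 1) ∧
    hyp43 1 1 (a + 1) (-(a + 1)) 2 2 2 1 = closedFormNeg (a + 1) ∧
    hyp43 1 1 (a + 1) (-1 - (a + 1)) 2 2 2 1 = closedFormNegOneSubReduced (a + 1) := by
  have hpi := ofReal_pi_ne_zero
  have ha1 := add_one_ne_neg_natCast ha
  have ha2 := add_one_ne_neg_natCast ha1
  have ha3 := add_one_ne_neg_natCast ha2
  have h0 := ne_zero_of_ne_neg_natCast ha
  have h1 := ne_zero_of_ne_neg_natCast ha1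
  have h2 : a + 2 ≠ 0 := fun h => ha 2 (by push_cast; linear_combination h)
  have h3 : a + 3 ≠ 0 := fun h => ha 3 (by push_cast; linear_combination h)
  -- All digammas are brought back to `a + 1`, the argument in `logSumClosed`, so that only rational
  -- identities remain.
  have p1 := Complex.digamma_apply_add_one _ ha1
  have p2 := Complex.digamma_apply_add_one _ ha2
  have p3 := Complex.digamma_apply_add_one _ ha3
  rw [show a + 1 + 1 = a + 2 by ring] at p1 p2 p3
  rw [show a + 2 + 1 = a + 3 by ring] at p2 p3
  rw [show a + 3 + 1 = a + 4 by ring] at p3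
  have S0 : ∑' n, logTerm a (-a - (0 : ℕ)) n = logSumClosed a := by
    simpa [logSum] using logSum_eq ha
  have G0 : ∑' n, gaussTerm a (-a - (0 : ℕ)) n = Complex.sin (Real.pi * a) / (Real.pi * a) := by
    simpa using tsum_gaussTerm_neg h0
  have G1 := tsum_gaussTerm_neg_sub ha 0
  have G2 := tsum_gaussTerm_neg_sub ha 1
  have G3 := tsum_gaussTerm_neg_sub ha 2
  have S1 := tsum_logTerm_neg_sub ha 0
  have S2 := tsum_logTerm_neg_sub ha 1
  have S3 := tsum_logTerm_neg_sub ha 2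
  simp only [zero_add] at G1 S1
  simp only [show (1 + 1 : ℕ) = 2 from rfl] at G2 S2
  simp only [show (2 + 1 : ℕ) = 3 from rfl] at G3 S3
  rw [G0, show a + (0 : ℕ) + 1 = a + 1 by simp, mul_comm, ← eq_div_iff h1] at G1
  rw [G1, show a + (1 : ℕ) + 1 = a + 2 by push_cast; ring, mul_comm, ← eq_div_iff h2] at G2
  rw [G2, show a + (2 : ℕ) + 1 = a + 3 by push_cast; ring, mul_comm, ← eq_div_iff h3] at G3
  rw [S0, G1, show a + (0 : ℕ) + 1 = a + 1 by simp] at S1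
  rw [S1, G2, show a + (1 : ℕ) + 1 = a + 2 by push_cast; ring] at S2
  rw [S2, G3, show a + (2 : ℕ) + 1 = a + 3 by push_cast; ring] at S3
  have H0 := (hasSum_hyp43Term ha 0).2
  have H1 := (hasSum_hyp43Term ha 1).2
  have H2 := (hasSum_hyp43Term ha 2).2
  have H3 := (hasSum_hyp43Term ha 3).2
  rw [S0, show 1 - a - (0 : ℕ) = 1 - a by simp] at H0
  rw [S1, show 1 - a - (1 : ℕ) = -a by push_cast; ring] at H1
  rw [S2, show 1 - a - (2 : ℕ) = -(a + 1) by push_cast; ring] at H2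
  rw [S3, show 1 - a - (3 : ℕ) = -1 - (a + 1) by push_cast; ring] at H3
  push_cast at H0 H1 H2 H3
  rw [add_zero] at H0
  have hsin := sin_pi_mul_add_one a
  have hGam : Complex.Gamma (a + 1 + 2) = (a + 2) * ((a + 1) * Complex.Gamma (a + 1)) := by
    rw [show a + 1 + 2 = a + 2 + 1 by ring, Complex.Gamma_add_one _ h2,
      show a + 2 = a + 1 + 1 by ring, Complex.Gamma_add_one _ h1]
  have hG0 := Complex.Gamma_ne_zero ha1
  rw [H0, H1, H2, H3]
  unfold logSumClosed
  refine ⟨?_, ?_, ?_, ?_⟩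
  · rw [closedFormTwoSub, hsin, add_sub_cancel_right]
    field_simp
    ring
  · rw [closedFormOneSub, hsin, add_sub_cancel_right, show a + 1 + 1 = a + 2 by ring, p1]
    field_simp
    ring
  · rw [closedFormNeg, hsin, add_sub_cancel_right, hGam, show a + 1 + 2 = a + 3 by ring,
      show a + 1 + 1 = a + 2 by ring, p2, p1]
    field_simp
    ring
  · rw [closedFormNegOneSubReduced, hsin, add_sub_cancel_right, show 3 + (a + 1) = a + 4 by ring,
      show a + 1 + 2 = a + 3 by ring, show a + 1 + 1 = a + 2 by ring, p3, p2, p1]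
    field_simp
    ring

theorem mainTheorem3 (c : ℂ) (hc1 : c ≠ 1) (hc : ∀ n : ℕ, c ≠ -(n : ℂ)) :
    (Summable (hyp43Term 1 1 c (2 - c) 2 2 2 1) ∧
      hyp43 1 1 c (2 - c) 2 2 2 1 = closedFormTwoSub c) ∧
    (Summable (hyp43Term 1 1 c (1 - c) 2 2 2 1) ∧
      hyp43 1 1 c (1 - c) 2 2 2 1 = closedFormOneSub c) ∧
    (Summable (hyp43Term 1 1 c (-c) 2 2 2 1) ∧
      hyp43 1 1 c (-c) 2 2 2 1 = closedFormNeg c) ∧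
    (Summable (hyp43Term 1 1 c (-1 - c) 2 2 2 1) ∧
      ((∀ n : ℕ, c ≠ -(3 / 2 : ℂ) - (n : ℂ)) →
        hyp43 1 1 c (-1 - c) 2 2 2 1 = closedFormNegOneSub c) ∧
      ((∃ n : ℕ, c = -(3 / 2 : ℂ) - (n : ℂ)) →
        Filter.Tendsto closedFormNegOneSub (nhdsWithin c {c}ᶜ)
          (nhds (hyp43 1 1 c (-1 - c) 2 2 2 1)))) := by
  -- The case `n = 0` is `c ≠ 1`; the others are the exclusion of nonpositive integers.
  have ha : ∀ n : ℕ, c - 1 ≠ -n := by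
    rintro (_ | n) h
    · exact hc1 (by simpa [sub_eq_zero] using h)
    · exact hc n (by push_cast at h; linear_combination h)
  have hs := fun m => (hasSum_hyp43Term ha m).1
  have s0 := hs 0
  have s1 := hs 1
  have s2 := hs 2
  have s3 := hs 3
  rw [sub_add_cancel] at s0 s1 s2 s3
  rw [show 1 - (c - 1) - (0 : ℕ) = 2 - c by push_cast; ring] at s0
  rw [show 1 - (c - 1) - (1 : ℕ) = 1 - c by push_cast; ring] at s1
  rw [show 1 - (c - 1) - (2 : ℕ) = -c by push_cast; ring] at s2
  rw [show 1 - (c - 1) - (3 : ℕ) = -1 - c by push_cast; ring] at s3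
  obtain ⟨e0, e1, e2, e3⟩ := closed_forms_eq ha
  rw [sub_add_cancel] at e0 e1 e2 e3
  rw [show 1 - (c - 1) = 2 - c by ring] at e0
  rw [neg_sub] at e1
  refine ⟨⟨s0, e0⟩, ⟨s1, e1⟩, ⟨s2, e2⟩, s3, fun hc2 => ?_, ?_⟩
  · rw [e3, closedFormNegOneSub_eq_reduced hc1 hc hc2]
  · rintro ⟨n, hn⟩
    rw [e3]
    have ht := (continuousAt_closedFormNegOneSubReduced hc1 hc).tendsto
    refine (ht.mono_left nhdsWithin_le_nhds).congr' ?_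
    have hball : ∀ᶠ w in 𝓝[≠] c, w ∈ Metric.ball c 1 :=
      nhdsWithin_le_nhds (Metric.ball_mem_nhds c one_pos)
    have hopen : ∀ᶠ w in 𝓝[≠] c, w ∈ {z : ℂ | ∀ n : ℕ, z ≠ -n} :=
      nhdsWithin_le_nhds (isOpen_setOf_ne_neg_natCast.mem_nhds hc)
    have hone : ∀ᶠ w in 𝓝[≠] c, w ≠ 1 := nhdsWithin_le_nhds (isOpen_ne.mem_nhds hc1)
    filter_upwards [hball, hopen, hone, self_mem_nhdsWithin] with w hw1 hw2 hw3 hw4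
    -- Exceptional points differ by integers, so the unit ball around `c` contains no other; on the
    -- punctured ball the original and the reduced form agree, and the latter is continuous at `c`.
    refine (closedFormNegOneSub_eq_reduced hw3 hw2 fun m hm => hw4 ?_).symm
    have hd : w - c = (((n : ℤ) - m : ℤ) : ℂ) := by
      rw [hm, hn]
      push_cast
      ring
    rw [mem_ball_iff_norm, hd, Complex.norm_intCast] at hw1
    have h0 : (n : ℤ) - m = 0 := Int.abs_lt_one_iff.1 (by exact_mod_cast hw1)
    rw [h0, Int.cast_zero] at hd
    exact sub_eq_zero.1 hd
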